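/- Let $\phi$ be a smooth real-valued function on an open neighbourhood $\Omega$ of the origin in $\mathbb R^2$ with $\phi(0,0)=0$ and $\nabla\phi(0,0)=0$, and let $c_{\alpha}=\frac1{\alpha_1!\alpha_2!}\partial_1^{\alpha_1}\partial_2^{\alpha_2}\phi(0,0)$, $\alpha\in\mathbb N^2$, be its Taylor coefficients at the origin. Assume that $\phi$ is of finite type at the origin, i.e. that the Taylor support $\mathcal T(\phi)=\{\alpha\in\mathbb N^2: c_\alpha\neq0\}$ is non-empty. The Newton polyhedron $\mathcal N(\phi)$ is the convex hull of $\bigcup_{\alpha\in\mathcal T(\phi)}(\alpha+[0,\infty)^2)$; its faces are its edges and its vertices. The Newton distance $d(\phi)$ is the number $d$ for which $(d,d)$ lies on the boundary of $\mathcal N(\phi)$. The principal face $\pi(\phi)$ is the face of minimal dimension of $\mathcal N(\phi)$ that contains $(d(\phi),d(\phi))$. If $\pi(\phi)$ is compact, the principal part of $\phi$ is the polynomial $\phi_{\mathrm{pr}}(x_1,x_2)=\sum_{\alpha\in\pi(\phi)}c_\alpha x_1^{\alpha_1}x_2^{\alpha_2}$, and $m(\phi_{\mathrm{pr}})$ denotes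 the maximum, over the points of the unit circle centred at the origin, of the order of vanishing of $\phi_{\mathrm{pr}}$ at the point. The height is $h(\phi)=\sup_y d_y$, the supremum being over all smooth local coordinate systems $y$ at the origin (local diffeomorphisms that preserve the origin), where $d_y$ is the Newton distance of $\phi$ expressed in the coordinates $y$. The given coordinates $x=(x_1,x_2)$ are called adapted to $\phi$ if $h(\phi)=d(\phi)$. **Proposition.** The coordinates $x$ are adapted to $\phi$ if and only if one of the following conditions is satisfied: (a) $\pi(\phi)$ is a compact edge, and $m(\phi_{\mathrm{pr}})\le d(\phi)$; (b) $\pi(\phi)$ is a vertex; (c) $\pi(\phi)$ is an unbounded edge. -/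

import Mathlib

open Set
open scoped ContDiff

namespace NewtonHeight

/-- The partial derivative `∂f/∂x₁` of a function of two real variables. -/
noncomputable def partial1 (f : ℝ × ℝ → ℝ) : ℝ × ℝ → ℝ := fun x => fderiv ℝ f x (1, 0)

/-- The partial derivative `∂f/∂x₂` of a function of two real variables. -/
noncomputable def partial2 (f : ℝ × ℝ → ℝ) : ℝ × ℝ → ℝ := fun x => fderiv ℝ f x (0, 1)

/-- The Taylor coefficient `∂₁^{α₁} ∂₂^{α₂} f (x) / (α₁! α₂!)` of `f` at the point `x`. -/
noncomputable def taylorCoeff (f : ℝ × ℝ → ℝ) (x : ℝ × ℝ) (α : ℕ × ℕ) : ℝ :=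
  (partial1^[α.1] (partial2^[α.2] f)) x / (α.1.factorial * α.2.factorial)

/-- The Taylor support of `φ` at the origin. -/
def taylorSupport (φ : ℝ × ℝ → ℝ) : Set (ℕ × ℕ) := {α | taylorCoeff φ 0 α ≠ 0}

/-- A multi-index, as a point of the real plane that contains the Newton polyhedron. -/
def toPlane (α : ℕ × ℕ) : ℝ × ℝ := ((α.1 : ℝ), (α.2 : ℝ))

/-- The Newton polyhedron of `φ` at the origin: the convex hull of the union of all
quadrants `α + [0, ∞)²` with `α` in the Taylor support. -/
def newtonPolyhedron (φ : ℝ × ℝ → ℝ) : Set (ℝ × ℝ) :=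
  convexHull ℝ (⋃ α ∈ taylorSupport φ,
    {t : ℝ × ℝ | (toPlane α).1 ≤ t.1 ∧ (toPlane α).2 ≤ t.2})

/-- The Newton distance `d(φ)`. For finite type `φ` it is the only real `t` for which `(t, t)`
lies on the boundary of the Newton polyhedron, see `diag_mem_frontier_iff` below. -/
noncomputable def newtonDistance (φ : ℝ × ℝ → ℝ) : ℝ :=
  sInf {t : ℝ | ((t, t) : ℝ × ℝ) ∈ newtonPolyhedron φ}

/-- The dimension of a subset of the plane, i.e. of its affine span. -/
noncomputable def dim (F : Set (ℝ × ℝ)) : ℕ := Module.finrank ℝ (vectorSpan ℝ F)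

/-- `F` is a vertex of the convex set `N` (a singleton that is cut out by a supporting line). -/
def IsVertex (N F : Set (ℝ × ℝ)) : Prop := F.Nonempty ∧ IsExposed ℝ N F ∧ dim F = 0

/-- `F` is an edge of the convex set `N` (a one-dimensional intersection of `N` with a
supporting line); it may be bounded or unbounded. -/
def IsEdge (N F : Set (ℝ × ℝ)) : Prop := F.Nonempty ∧ IsExposed ℝ N F ∧ dim F = 1

/-- A face is an edge or a vertex. -/
def IsFace (N F : Set (ℝ × ℝ)) : Prop := IsEdge N F ∨ IsVertex N F

/-- `F` is the principal face of the Newton polyhedron of `φ`: the face of minimal dimension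
that contains the point `(d, d)`, where `d` is the Newton distance. -/
def IsPrincipalFace (φ : ℝ × ℝ → ℝ) (F : Set (ℝ × ℝ)) : Prop :=
  IsFace (newtonPolyhedron φ) F ∧ (newtonDistance φ, newtonDistance φ) ∈ F ∧
    ∀ G, IsFace (newtonPolyhedron φ) G → (newtonDistance φ, newtonDistance φ) ∈ G →
      dim F ≤ dim G

/-- The part `∑_{α ∈ F} c_α x₁^{α₁} x₂^{α₂}` of the Taylor series of `φ` that belongs to a
compact face `F`. It is a polynomial function, as a compact set contains only finitely many
multi-indices. When `F` is the principal face, it is the principal part of `φ`. -/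
noncomputable def facePart (φ : ℝ × ℝ → ℝ) (F : Set (ℝ × ℝ)) : ℝ × ℝ → ℝ := fun x =>
  ∑ᶠ (α : ℕ × ℕ) (_ : toPlane α ∈ F), taylorCoeff φ 0 α * x.1 ^ α.1 * x.2 ^ α.2

/-- The order of vanishing of `f` at `x`: the least order of a partial derivative of `f` that
does not vanish at `x` (`⊤` if there is none). -/
noncomputable def vanishingOrder (f : ℝ × ℝ → ℝ) (x : ℝ × ℝ) : ℕ∞ :=
  ⨅ (α : ℕ × ℕ) (_ : taylorCoeff f x α ≠ 0), ((α.1 + α.2 : ℕ) : ℕ∞)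

/-- The maximal order of vanishing of `f` along the unit circle centred at the origin. -/
noncomputable def circleOrder (f : ℝ × ℝ → ℝ) : ℕ∞ :=
  ⨆ (x : ℝ × ℝ) (_ : x.1 ^ 2 + x.2 ^ 2 = 1), vanishingOrder f x

/-- `y` is a local coordinate system at the origin: a smooth diffeomorphism between open
neighbourhoods of the origin that preserves the origin. A function `φ` is expressed in the
coordinates `y` by `φ ∘ y.symm`. -/
def IsLocalCoordinates (y : OpenPartialHomeomorph (ℝ × ℝ) (ℝ × ℝ)) : Prop :=
  (0 : ℝ × ℝ) ∈ y.source ∧ y 0 = 0 ∧ ContDiffOn ℝ ∞ y y.source ∧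
    ContDiffOn ℝ ∞ y.symm y.target

/-- The height `h(φ)`: the supremum of the Newton distances of `φ` in all local coordinate
systems at the origin. -/
noncomputable def height (φ : ℝ × ℝ → ℝ) : EReal :=
  ⨆ (y : OpenPartialHomeomorph (ℝ × ℝ) (ℝ × ℝ)) (_ : IsLocalCoordinates y),
    ((newtonDistance (φ ∘ y.symm) : ℝ) : EReal)

/-- The coordinates in which `φ` is given are adapted to `φ`. -/
def IsAdapted (φ : ℝ × ℝ → ℝ) : Prop := height φ = ((newtonDistance φ : ℝ) : EReal)

/-! Consistency of the definition of the Newton distance. -/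

theorem newtonPolyhedron_upward {φ : ℝ × ℝ → ℝ} {s t : ℝ × ℝ} (hs : s ∈ newtonPolyhedron φ)
    (h : s ≤ t) : t ∈ newtonPolyhedron φ := by
  have hv : 0 ≤ t - s := sub_nonneg.2 h
  generalize hw : t - s = v at hv
  have hsub : newtonPolyhedron φ ⊆ (fun z => v + z) ⁻¹' newtonPolyhedron φ := by
    refine convexHull_min ?_ ((convex_convexHull ℝ _).translate_preimage_right v)
    intro z hz
    simp only [mem_iUnion, exists_prop] at hz
    obtain ⟨α, hα, h1, h2⟩ := hz
    refine subset_convexHull ℝ _ ?_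
    simp only [mem_iUnion, exists_prop]
    refine ⟨α, hα, ?_, ?_⟩
    · have := hv.1; simp only [Prod.fst_zero, Prod.fst_add] at *; linarith
    · have := hv.2; simp only [Prod.snd_zero, Prod.snd_add] at *; linarith
  have := hsub hs
  rw [mem_preimage, ← hw, sub_add_cancel] at this
  exact this

theorem newtonPolyhedron_nonneg {φ : ℝ × ℝ → ℝ} {s : ℝ × ℝ} (hs : s ∈ newtonPolyhedron φ) :
    0 ≤ s := by
  have : newtonPolyhedron φ ⊆ Ici (0 : ℝ × ℝ) := by
    refine convexHull_min ?_ (convex_Ici 0)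
    intro z hz
    simp only [mem_iUnion, exists_prop] at hz
    obtain ⟨α, -, h1, h2⟩ := hz
    exact ⟨le_trans (Nat.cast_nonneg _) h1, le_trans (Nat.cast_nonneg _) h2⟩
  exact this hs

theorem diag_mem_frontier_iff {φ : ℝ × ℝ → ℝ} (hφ : (taylorSupport φ).Nonempty) (t : ℝ) :
    ((t, t) : ℝ × ℝ) ∈ frontier (newtonPolyhedron φ) ↔ t = newtonDistance φ := by
  have hbdd : BddBelow {t : ℝ | ((t, t) : ℝ × ℝ) ∈ newtonPolyhedron φ} :=
    ⟨0, fun t ht => (newtonPolyhedron_nonneg ht).1⟩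
  have hne : {t : ℝ | ((t, t) : ℝ × ℝ) ∈ newtonPolyhedron φ}.Nonempty := by
    obtain ⟨α, hα⟩ := hφ
    refine ⟨max (α.1 : ℝ) α.2, subset_convexHull ℝ _ ?_⟩
    simp only [mem_iUnion, exists_prop]
    exact ⟨α, hα, le_max_left _ _, le_max_right _ _⟩
  have hgt : ∀ s, newtonDistance φ < s → ((s, s) : ℝ × ℝ) ∈ newtonPolyhedron φ := by
    intro s hs
    obtain ⟨r, hr, hrs⟩ := exists_lt_of_csInf_lt hne hs
    exact newtonPolyhedron_upward hr ⟨hrs.le, hrs.le⟩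
  have hclo : ∀ s, ((s, s) : ℝ × ℝ) ∈ closure (newtonPolyhedron φ) ↔ newtonDistance φ ≤ s := by
    intro s
    constructor
    · intro hs
      refine le_of_forall_pos_le_add fun ε hε => ?_
      obtain ⟨z, hz, hd⟩ := Metric.mem_closure_iff.1 hs ε hε
      rw [Prod.dist_eq, max_lt_iff, Real.dist_eq, Real.dist_eq, abs_lt, abs_lt] at hd
      refine csInf_le hbdd (newtonPolyhedron_upward hz ⟨?_, ?_⟩)
      · have := hd.1.1; simp only at *; linarith
      · have := hd.2.1; simp only at *; linarith
    · intro hs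
      refine Metric.mem_closure_iff.2 fun ε hε => ⟨(s + ε / 2, s + ε / 2), hgt _ (by linarith), ?_⟩
      rw [Prod.dist_eq, max_lt_iff, Real.dist_eq, abs_lt]
      constructor <;> constructor <;> simp only <;> linarith
  have hint : ∀ s, ((s, s) : ℝ × ℝ) ∈ interior (newtonPolyhedron φ) ↔ newtonDistance φ < s := by
    intro s
    constructor
    · intro hs
      obtain ⟨ε, hε, hb⟩ := Metric.mem_nhds_iff.1 (mem_interior_iff_mem_nhds.1 hs)
      have : ((s - ε / 2, s - ε / 2) : ℝ × ℝ) ∈ newtonPolyhedron φ := by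
        apply hb
        rw [Metric.mem_ball, Prod.dist_eq, max_lt_iff, Real.dist_eq, abs_lt]
        constructor <;> constructor <;> simp only <;> linarith
      have : newtonDistance φ ≤ s - ε / 2 := csInf_le hbdd this
      linarith
    · intro hs
      obtain ⟨r, hr, hrs⟩ := exists_between hs
      refine mem_interior_iff_mem_nhds.2 (Metric.mem_nhds_iff.2 ⟨s - r, by linarith, ?_⟩)
      intro z hz
      rw [Metric.mem_ball, Prod.dist_eq, max_lt_iff, Real.dist_eq, Real.dist_eq, abs_lt,
        abs_lt] at hz
      refine newtonPolyhedron_upward (hgt r hr) ⟨?_, ?_⟩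
      · have := hz.1.1; simp only at *; linarith
      · have := hz.2.1; simp only at *; linarith
  rw [frontier, mem_sdiff, hclo, hint, not_lt]
  exact ⟨fun h => le_antisymm h.2 h.1, fun h => ⟨h.ge, h.le⟩⟩

end NewtonHeight

open NewtonHeight

/-!
Write `d` for the Newton distance of `φ`, and for positive weights `w` call the lowest
`w`-homogeneous part of the Taylor series of `φ` its initial form. Everything rests on the scaling
behaviour of smooth functions: by Taylor's theorem, `φ (r ^ w₁ x₁, r ^ w₂ x₂) / r ^ D` tends to the
initial form of degree `D` (`tendsto_initialForm`), and conversely such limits determine the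
initial form (`initialForm_of_tendsto`). This computes initial forms of `φ ∘ ψ` without power
series (`initialForm_comp`), and it identifies orders of vanishing with orders of growth
(`le_vanishingOrder_iff`).

*The conditions suffice.* A supporting line shows that the Newton distance of `φ ∘ ψ` exceeds `d`
only if, for some positive weights, every weight in the Taylor support of `φ ∘ ψ` exceeds
`(κ₁ + κ₂) d`. After interchanging coordinates the weights are `(1, t)` with `t ≥ 1`, and `ψ₁` has
a nonzero linear term in `u`. Let `s ≤ t` be the least of `t` and of the order of `ψ₂ (u, 0)`. With
the weights `(1, s)` the initial form of `φ ∘ ψ` is the initial form of `φ` composed with an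
invertible quasi-homogeneous map, so it has the same degree, at most `(1 + s) d`. If `s < t`, this
map sends `(1, 0)` to a point off the axes. The order of vanishing of the initial form of `φ` there
is at most `d`, hence some term of the initial form of `φ ∘ ψ` contains `v` to a power at most `d`,
and its `(1, t)`-weight is at most `(1 + t) d` (`exists_weight_le_of_one_le`). The bound on the
order of vanishing is where the conditions enter: a nonzero real root of a polynomial has
multiplicity less than the number of terms (`lt_card_support_of_pow_dvd`), so an initial form
vanishing to order greater than `d` has many terms, its exponents lie on both sides of the diagonal,
and it must be the principal part, on a compact edge (`face_eq_of_both_sides`).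

*The conditions are necessary.* If they fail, the principal face is a compact edge and the principal
part vanishes to order greater than `d` at some point, which does not lie on an axis
(`lt_newtonDistance_of_tilt`). The number of terms forces one weight to be an integer multiple of
the other one (`exists_nat_weight_ratio`), so the point lies on a curve `x₂ = λ x₁ ^ k`, or the same
with the coordinates interchanged. Straightening this curve pushes all terms of the initial form
strictly to one side of `(d, d)`, which increases the Newton distance
(`lt_newtonDistance_comp_shear`).
-/

namespace NewtonHeight

open Filter Topology Asymptotics

section

/-! ### Mixed partial derivatives of smooth germs -/

/-- The mixed partial derivative `∂₁^a ∂₂^b f`. -/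
noncomputable def mixedPartial (a b : ℕ) (f : ℝ × ℝ → ℝ) : ℝ × ℝ → ℝ :=
  partial1^[a] (partial2^[b] f)

lemma taylorCoeff_eq (f : ℝ × ℝ → ℝ) (x : ℝ × ℝ) (α : ℕ × ℕ) :
    taylorCoeff f x α = mixedPartial α.1 α.2 f x / (α.1.factorial * α.2.factorial) := rfl

lemma taylorCoeff_eq_zero_iff {f : ℝ × ℝ → ℝ} {x : ℝ × ℝ} {α : ℕ × ℕ} :
    taylorCoeff f x α = 0 ↔ mixedPartial α.1 α.2 f x = 0 := by
  rw [taylorCoeff_eq, div_eq_zero_iff]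
  have : ((α.1.factorial : ℝ) * α.2.factorial) ≠ 0 := by positivity
  tauto

lemma mixedPartial_succ_right (a b : ℕ) (f : ℝ × ℝ → ℝ) :
    mixedPartial a (b + 1) f = mixedPartial a b (partial2 f) := rfl

lemma mixedPartial_succ_left (a b : ℕ) (f : ℝ × ℝ → ℝ) :
    mixedPartial (a + 1) b f = partial1 (mixedPartial a b f) :=
  Function.iterate_succ_apply' _ _ _

variable {f g : ℝ × ℝ → ℝ} {x : ℝ × ℝ}

lemma smooth_partial1 (hf : ContDiffAt ℝ ∞ f x) : ContDiffAt ℝ ∞ (partial1 f) x :=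
  (hf.fderiv_right (m := ∞) (by simp)).clm_apply contDiffAt_const

lemma smooth_partial2 (hf : ContDiffAt ℝ ∞ f x) : ContDiffAt ℝ ∞ (partial2 f) x :=
  (hf.fderiv_right (m := ∞) (by simp)).clm_apply contDiffAt_const

lemma smooth_mixedPartial (hf : ContDiffAt ℝ ∞ f x) (a b : ℕ) :
    ContDiffAt ℝ ∞ (mixedPartial a b f) x := by
  induction a with
  | zero =>
    induction b generalizing f with
    | zero => exact hf
    | succ b ih => exact ih (smooth_partial2 hf)
  | succ a ih => rw [mixedPartial_succ_left]; exact smooth_partial1 ih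

lemma eventually_differentiableAt (hf : ContDiffAt ℝ ∞ f x) :
    ∀ᶠ y in 𝓝 x, DifferentiableAt ℝ f y := by
  have h1 : ContDiffAt ℝ 1 f x := hf.of_le (by exact_mod_cast le_top)
  filter_upwards [h1.eventually (by simp)] with y hy
  exact hy.differentiableAt (by simp)

lemma partial1_congr (h : f =ᶠ[𝓝 x] g) : partial1 f =ᶠ[𝓝 x] partial1 g :=
  h.fderiv.fun_comp (fun L : ℝ × ℝ →L[ℝ] ℝ => L (1, 0))

lemma partial2_congr (h : f =ᶠ[𝓝 x] g) : partial2 f =ᶠ[𝓝 x] partial2 g :=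
  h.fderiv.fun_comp (fun L : ℝ × ℝ →L[ℝ] ℝ => L (0, 1))

lemma mixedPartial_congr (h : f =ᶠ[𝓝 x] g) (a b : ℕ) :
    mixedPartial a b f =ᶠ[𝓝 x] mixedPartial a b g := by
  induction a with
  | zero =>
    induction b generalizing f g with
    | zero => exact h
    | succ b ih => exact ih (partial2_congr h)
  | succ a ih => simp only [mixedPartial_succ_left]; exact partial1_congr ih

lemma partial_comm (hf : ContDiffAt ℝ ∞ f x) :
    partial2 (partial1 f) =ᶠ[𝓝 x] partial1 (partial2 f) := by
  have h2 : ContDiffAt ℝ 2 f x := contDiffAt_infty.1 hf 2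
  filter_upwards [h2.eventually (by simp)] with y hy
  have hs : IsSymmSndFDerivAt ℝ f y := hy.isSymmSndFDerivAt (by simp)
  have hd : DifferentiableAt ℝ (fderiv ℝ f) y :=
    (hy.fderiv_right (m := 1) (by norm_num)).differentiableAt (by simp)
  have key : ∀ v w : ℝ × ℝ, fderiv ℝ (fun z => fderiv ℝ f z v) y w
      = fderiv ℝ (fderiv ℝ f) y w v := by
    intro v w
    rw [fderiv_clm_apply hd (differentiableAt_const v)]
    simp
  change fderiv ℝ (fun z => fderiv ℝ f z (1, 0)) y (0, 1)
    = fderiv ℝ (fun z => fderiv ℝ f z (0, 1)) y (1, 0)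
  rw [key, key, hs.eq]

lemma mixedPartial_partial2 (hf : ContDiffAt ℝ ∞ f x) (a b : ℕ) :
    partial2 (mixedPartial a b f) =ᶠ[𝓝 x] mixedPartial a (b + 1) f := by
  induction a with
  | zero => rw [show mixedPartial 0 (b + 1) f = partial2 (mixedPartial 0 b f) from
      Function.iterate_succ_apply' _ _ _]
  | succ a ih =>
    simp only [mixedPartial_succ_left]
    exact (partial_comm (smooth_mixedPartial hf a b)).trans (partial1_congr ih)

lemma mixedPartial_partial1 (hf : ContDiffAt ℝ ∞ f x) (a b : ℕ) :
    mixedPartial a b (partial1 f) =ᶠ[𝓝 x] mixedPartial (a + 1) b f := by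
  induction b generalizing a with
  | zero => exact Eventually.of_forall fun y => rfl
  | succ b ih =>
    exact ((mixedPartial_partial2 (smooth_partial1 hf) a b).symm.trans
      (partial2_congr (ih a))).trans (mixedPartial_partial2 hf (a + 1) b)

lemma partial1_sub (hf : ContDiffAt ℝ ∞ f x) (hg : ContDiffAt ℝ ∞ g x) :
    partial1 (f - g) =ᶠ[𝓝 x] partial1 f - partial1 g := by
  filter_upwards [eventually_differentiableAt hf, eventually_differentiableAt hg] with y h1 h2
  simp [partial1, fderiv_sub h1 h2]

lemma partial2_sub (hf : ContDiffAt ℝ ∞ f x) (hg : ContDiffAt ℝ ∞ g x) :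
    partial2 (f - g) =ᶠ[𝓝 x] partial2 f - partial2 g := by
  filter_upwards [eventually_differentiableAt hf, eventually_differentiableAt hg] with y h1 h2
  simp [partial2, fderiv_sub h1 h2]

lemma mixedPartial_sub (hf : ContDiffAt ℝ ∞ f x) (hg : ContDiffAt ℝ ∞ g x) (a b : ℕ) :
    mixedPartial a b (f - g) =ᶠ[𝓝 x] mixedPartial a b f - mixedPartial a b g := by
  induction a with
  | zero =>
    induction b generalizing f g with
    | zero => exact EventuallyEq.rfl
    | succ b ih =>
      exact (mixedPartial_congr (partial2_sub hf hg) 0 b).trans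
        (ih (smooth_partial2 hf) (smooth_partial2 hg))
  | succ a ih =>
    simp only [mixedPartial_succ_left]
    exact (partial1_congr ih).trans
      (partial1_sub (smooth_mixedPartial hf a b) (smooth_mixedPartial hg a b))

/-! ### Taylor's theorem in the plane -/

lemma apply_eq_coords (l : ℝ × ℝ →L[ℝ] ℝ) (v : ℝ × ℝ) :
    l v = v.1 * l (1, 0) + v.2 * l (0, 1) := by
  conv_lhs => rw [show v = v.1 • ((1, 0) : ℝ × ℝ) + v.2 • ((0, 1) : ℝ × ℝ) by ext <;> simp]
  rw [map_add, map_smul, map_smul, smul_eq_mul, smul_eq_mul]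

lemma norm_le_add_apply (L : ℝ × ℝ →L[ℝ] ℝ) : ‖L‖ ≤ ‖L (1, 0)‖ + ‖L (0, 1)‖ := by
  refine L.opNorm_le_bound (by positivity) fun v => ?_
  calc ‖L v‖ ≤ ‖v.1‖ * ‖L (1, 0)‖ + ‖v.2‖ * ‖L (0, 1)‖ := by
        rw [apply_eq_coords L v]; exact (norm_add_le _ _).trans (by rw [norm_mul, norm_mul])
    _ ≤ ‖v‖ * ‖L (1, 0)‖ + ‖v‖ * ‖L (0, 1)‖ := by
        gcongr
        · exact norm_fst_le v
        · exact norm_snd_le v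
    _ = _ := by ring

/-- A smooth function whose partial derivatives of order less than `n` vanish at `x` is
`O(‖h‖ ^ n)` at `x + h`. -/
theorem isBigO_of_mixedPartial_eq_zero (n : ℕ) (hf : ContDiffAt ℝ ∞ f x)
    (h : ∀ a b, a + b < n → mixedPartial a b f x = 0) :
    (fun v => f (x + v)) =O[𝓝 0] fun v => ‖v‖ ^ n := by
  have htend : Tendsto (fun v => x + v) (𝓝 0) (𝓝 x) := by
    have : ContinuousAt (fun v => x + v) 0 := by fun_prop
    simpa [ContinuousAt] using this
  induction n generalizing f with
  | zero =>
    simp only [pow_zero]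
    exact (hf.continuousAt.tendsto.comp htend).isBigO_one ℝ
  | succ n ih =>
    have h1 := ih (smooth_partial1 hf) fun a b hab => by
      rw [(mixedPartial_partial1 hf a b).eq_of_nhds]
      exact h _ _ (by omega)
    have h2 := ih (smooth_partial2 hf) fun a b hab => by
      rw [← mixedPartial_succ_right]
      exact h _ _ (by omega)
    obtain ⟨C1, hC1⟩ := h1.bound
    obtain ⟨C2, hC2⟩ := h2.bound
    obtain ⟨ε, hε, hball⟩ := Metric.eventually_nhds_iff_ball.1
      ((hC1.and hC2).and (htend.eventually (eventually_differentiableAt hf)))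
    refine IsBigO.of_bound (C1 + C2) (Metric.eventually_nhds_iff_ball.2 ⟨ε, hε, fun v hv => ?_⟩)
    have hf0 : f x = 0 := h 0 0 (by omega)
    have hsub : ∀ u ∈ Metric.closedBall (0 : ℝ × ℝ) ‖v‖, u ∈ Metric.ball (0 : ℝ × ℝ) ε := by
      intro u hu
      rw [mem_closedBall_zero_iff] at hu
      rw [mem_ball_zero_iff] at hv ⊢
      exact hu.trans_lt hv
    have hCnn : 0 ≤ (C1 + C2) * ‖v‖ ^ n := by
      obtain ⟨⟨b1, b2⟩, -⟩ := hball v hv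
      have e1 := (norm_nonneg _).trans b1
      have e2 := (norm_nonneg _).trans b2
      rw [norm_pow, norm_norm] at e1 e2
      linarith
    have hderiv : ∀ u ∈ Metric.closedBall (0 : ℝ × ℝ) ‖v‖,
        HasFDerivWithinAt (fun u => f (x + u)) (fderiv ℝ f (x + u))
          (Metric.closedBall (0 : ℝ × ℝ) ‖v‖) u := by
      intro u hu
      have hd := (hball u (hsub u hu)).2
      have : HasFDerivAt (fun u => f (x + u)) (fderiv ℝ f (x + u)) u := by
        rw [hasFDerivAt_comp_add_left]
        exact hd.hasFDerivAt
      exact this.hasFDerivWithinAt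
    have hbd : ∀ u ∈ Metric.closedBall (0 : ℝ × ℝ) ‖v‖,
        ‖fderiv ℝ f (x + u)‖ ≤ (C1 + C2) * ‖v‖ ^ n := by
      intro u hu
      obtain ⟨⟨b1, b2⟩, -⟩ := hball u (hsub u hu)
      rw [norm_pow, norm_norm] at b1 b2
      rw [mem_closedBall_zero_iff] at hu
      have b12 : ‖fderiv ℝ f (x + u)‖ ≤ (C1 + C2) * ‖u‖ ^ n :=
        (norm_le_add_apply _).trans (by simp only [partial1, partial2] at b1 b2; linarith)
      rcases le_or_gt 0 (C1 + C2) with hC | hC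
      · exact b12.trans (by gcongr)
      · have : 0 ≤ ‖u‖ ^ n := by positivity
        nlinarith [norm_nonneg (fderiv ℝ f (x + u))]
    have := (convex_closedBall (0 : ℝ × ℝ) ‖v‖).norm_image_sub_le_of_norm_hasFDerivWithin_le
      hderiv hbd (Metric.mem_closedBall_self (norm_nonneg v))
      (show v ∈ Metric.closedBall (0 : ℝ × ℝ) ‖v‖ by simp)
    rw [add_zero, hf0, sub_zero, sub_zero] at this
    rw [norm_pow, norm_norm, pow_succ, ← mul_assoc]
    exact this

lemma mixedPartial_monomial (c : ℝ) (i j a b : ℕ) :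
    mixedPartial a b (fun x => c * x.1 ^ i * x.2 ^ j) = fun x =>
      c * (i.descFactorial a * j.descFactorial b) * x.1 ^ (i - a) * x.2 ^ (j - b) := by
  induction a with
  | zero =>
    induction b generalizing c j with
    | zero => simp [mixedPartial]
    | succ b ih =>
      rw [mixedPartial_succ_right]
      have h2 : partial2 (fun x : ℝ × ℝ => c * x.1 ^ i * x.2 ^ j)
          = fun x => (c * j) * x.1 ^ i * x.2 ^ (j - 1) := by
        ext y
        have h1 : HasFDerivAt (fun x : ℝ × ℝ => x.1) (ContinuousLinearMap.fst ℝ ℝ ℝ) y :=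
          hasFDerivAt_fst
        have h2 : HasFDerivAt (fun x : ℝ × ℝ => x.2) (ContinuousLinearMap.snd ℝ ℝ ℝ) y :=
          hasFDerivAt_snd
        have := ((h1.pow i).const_mul c).mul (h2.pow j)
        refine (congrArg (fun L : ℝ × ℝ →L[ℝ] ℝ => L (0, 1)) this.fderiv).trans ?_
        simp
        ring
      rw [h2, ih]
      ext y
      rcases j with _ | j
      · simp
      · rw [show j + 1 - 1 = j by omega, Nat.succ_descFactorial_succ,
          show j + 1 - (b + 1) = j - b by omega]
        push_cast
        ring
  | succ a ih =>
    rw [mixedPartial_succ_left, ih]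
    ext y
    have h1 : HasFDerivAt (fun x : ℝ × ℝ => x.1) (ContinuousLinearMap.fst ℝ ℝ ℝ) y :=
      hasFDerivAt_fst
    have h2 : HasFDerivAt (fun x : ℝ × ℝ => x.2) (ContinuousLinearMap.snd ℝ ℝ ℝ) y :=
      hasFDerivAt_snd
    have := ((h1.pow (i - a)).const_mul
      (c * (i.descFactorial a * j.descFactorial b))).mul (h2.pow (j - b))
    refine (congrArg (fun L : ℝ × ℝ →L[ℝ] ℝ => L (1, 0)) this.fderiv).trans ?_
    simp [Nat.descFactorial_succ, Nat.sub_sub]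
    ring

lemma taylorCoeff_monomial (c : ℝ) (β α : ℕ × ℕ) :
    taylorCoeff (fun x => c * x.1 ^ β.1 * x.2 ^ β.2) 0 α = if α = β then c else 0 := by
  rw [taylorCoeff_eq, mixedPartial_monomial]
  split_ifs with h
  · subst h
    have h1 := Nat.cast_ne_zero (R := ℝ).2 α.1.factorial_ne_zero
    have h2 := Nat.cast_ne_zero (R := ℝ).2 α.2.factorial_ne_zero
    simp [Nat.descFactorial_self]
    field_simp
  · rw [div_eq_zero_iff]
    left
    have : α.1 ≠ β.1 ∨ α.2 ≠ β.2 := by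
      by_contra hc
      push Not at hc
      exact h (Prod.ext hc.1 hc.2)
    rcases this with h | h
    · rcases lt_or_gt_of_ne h with h | h
      · simp [show β.1 - α.1 ≠ 0 by omega]
      · simp [Nat.descFactorial_eq_zero_iff_lt.2 h]
    · rcases lt_or_gt_of_ne h with h | h
      · simp [show β.2 - α.2 ≠ 0 by omega]
      · simp [Nat.descFactorial_eq_zero_iff_lt.2 h]

lemma contDiff_monomial (c : ℝ) (β : ℕ × ℕ) :
    ContDiff ℝ ∞ (fun x : ℝ × ℝ => c * x.1 ^ β.1 * x.2 ^ β.2) := by fun_prop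

lemma taylorCoeff_sub (hf : ContDiffAt ℝ ∞ f x) (hg : ContDiffAt ℝ ∞ g x) (α : ℕ × ℕ) :
    taylorCoeff (f - g) x α = taylorCoeff f x α - taylorCoeff g x α := by
  simp only [taylorCoeff_eq, (mixedPartial_sub hf hg α.1 α.2).eq_of_nhds, Pi.sub_apply, sub_div]

lemma taylorCoeff_sub_monomials (hf : ContDiffAt ℝ ∞ f 0) (c : ℕ × ℕ → ℝ) (S : Finset (ℕ × ℕ))
    (α : ℕ × ℕ) :
    taylorCoeff (f - fun x => ∑ β ∈ S, c β * x.1 ^ β.1 * x.2 ^ β.2) 0 α =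
      taylorCoeff f 0 α - if α ∈ S then c α else 0 := by
  induction S using Finset.induction_on with
  | empty => simp [show (f - fun _ : ℝ × ℝ => (0 : ℝ)) = f from sub_zero f]
  | insert β S hβ ih =>
    have hsum : ContDiff ℝ ∞ (fun x : ℝ × ℝ => ∑ β ∈ S, c β * x.1 ^ β.1 * x.2 ^ β.2) :=
      ContDiff.sum fun β _ => contDiff_monomial _ _
    have : (f - fun x : ℝ × ℝ => ∑ β ∈ insert β S, c β * x.1 ^ β.1 * x.2 ^ β.2)
        = (f - fun x : ℝ × ℝ => ∑ β ∈ S, c β * x.1 ^ β.1 * x.2 ^ β.2)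
          - fun x => c β * x.1 ^ β.1 * x.2 ^ β.2 := by
      ext x
      simp only [Pi.sub_apply, Finset.sum_insert hβ]
      ring
    have hd : ContDiffAt ℝ ∞ (f - fun x : ℝ × ℝ => ∑ β ∈ S, c β * x.1 ^ β.1 * x.2 ^ β.2) 0 :=
      hf.sub hsum.contDiffAt
    rw [this, taylorCoeff_sub hd (contDiff_monomial _ _).contDiffAt, ih, taylorCoeff_monomial]
    by_cases h : α = β
    · subst h; simp [hβ]
    · simp [h]

/-- The multi-indices of order less than `n`. -/
def lowIndices (n : ℕ) : Finset (ℕ × ℕ) :=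
  (Finset.range n ×ˢ Finset.range n).filter fun α => α.1 + α.2 < n

lemma mem_lowIndices {n : ℕ} {α : ℕ × ℕ} : α ∈ lowIndices n ↔ α.1 + α.2 < n := by
  simp only [lowIndices, Finset.mem_filter, Finset.mem_product, Finset.mem_range]
  omega

/-- Taylor's theorem at the origin of the plane. -/
theorem taylor_isBigO (hf : ContDiffAt ℝ ∞ f 0) (n : ℕ) :
    (fun v => f v - ∑ β ∈ lowIndices n, taylorCoeff f 0 β * v.1 ^ β.1 * v.2 ^ β.2)
      =O[𝓝 0] fun v => ‖v‖ ^ n := by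
  have hsum : ContDiff ℝ ∞ (fun x : ℝ × ℝ =>
      ∑ β ∈ lowIndices n, taylorCoeff f 0 β * x.1 ^ β.1 * x.2 ^ β.2) :=
    ContDiff.sum fun β _ => contDiff_monomial _ _
  have := isBigO_of_mixedPartial_eq_zero (x := 0) n (hf.sub hsum.contDiffAt) fun a b hab => by
    have := taylorCoeff_sub_monomials hf (taylorCoeff f 0) (lowIndices n) (a, b)
    rw [if_pos (mem_lowIndices.2 hab), sub_self] at this
    exact taylorCoeff_eq_zero_iff.1 this
  simpa using this

end

section

/-! ### Weighted initial forms -/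

/-- The weighted degree `w₁ α₁ + w₂ α₂` of a multi-index. -/
def weight (w : ℝ × ℝ) (α : ℕ × ℕ) : ℝ := w.1 * α.1 + w.2 * α.2

/-- The line `w₁ t₁ + w₂ t₂ = D`. -/
def weightLine (w : ℝ × ℝ) (D : ℝ) : Set (ℝ × ℝ) := {t | w.1 * t.1 + w.2 * t.2 = D}

/-- The non-isotropic dilation `(x₁, x₂) ↦ (r ^ w₁ x₁, r ^ w₂ x₂)`. -/
noncomputable def dilate (w : ℝ × ℝ) (r : ℝ) (x : ℝ × ℝ) : ℝ × ℝ :=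
  (r ^ w.1 * x.1, r ^ w.2 * x.2)

/-- The part of the Taylor series of `f` at the origin that is `w`-homogeneous of degree `D`. -/
noncomputable def initialForm (f : ℝ × ℝ → ℝ) (w : ℝ × ℝ) (D : ℝ) : ℝ × ℝ → ℝ :=
  facePart f (weightLine w D)

open Classical in
/-- The Taylor support of the `w`-homogeneous part of degree `D`, for positive weights `w`
(junk `∅` if there are infinitely many such multi-indices). -/
noncomputable def initialSupport (f : ℝ × ℝ → ℝ) (w : ℝ × ℝ) (D : ℝ) : Finset (ℕ × ℕ) :=
  if h : {α | α ∈ taylorSupport f ∧ weight w α = D}.Finite then h.toFinset else ∅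

variable {f : ℝ × ℝ → ℝ} {w : ℝ × ℝ} {D : ℝ}

lemma toPlane_mem_weightLine {α : ℕ × ℕ} : toPlane α ∈ weightLine w D ↔ weight w α = D := Iff.rfl

lemma mul_order_le_weight (α : ℕ × ℕ) : min w.1 w.2 * (α.1 + α.2 : ℕ) ≤ weight w α := by
  have h1 := min_le_left w.1 w.2
  have h2 := min_le_right w.1 w.2
  have h3 : (0 : ℝ) ≤ α.1 := Nat.cast_nonneg _
  have h4 : (0 : ℝ) ≤ α.2 := Nat.cast_nonneg _
  rw [weight, Nat.cast_add]
  nlinarith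

lemma exists_lowIndices (hw1 : 0 < w.1) (hw2 : 0 < w.2) (D : ℝ) :
    ∃ n : ℕ, D < n * min w.1 w.2 ∧ ∀ α, weight w α ≤ D → α ∈ lowIndices n := by
  have hm : 0 < min w.1 w.2 := lt_min hw1 hw2
  obtain ⟨n, hn⟩ := exists_nat_gt (D / min w.1 w.2)
  rw [div_lt_iff₀ hm] at hn
  refine ⟨n, hn, fun α hα => ?_⟩
  rw [mem_lowIndices]
  have := mul_order_le_weight (w := w) α
  by_contra hc
  push Not at hc
  have : (n : ℝ) ≤ (α.1 + α.2 : ℕ) := by exact_mod_cast hc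
  nlinarith

lemma finite_weight_le (hw1 : 0 < w.1) (hw2 : 0 < w.2) (D : ℝ) :
    {α | weight w α ≤ D}.Finite := by
  obtain ⟨n, -, hn⟩ := exists_lowIndices hw1 hw2 D
  exact (lowIndices n).finite_toSet.subset hn

lemma mem_initialSupport (hw1 : 0 < w.1) (hw2 : 0 < w.2) {α : ℕ × ℕ} :
    α ∈ initialSupport f w D ↔ α ∈ taylorSupport f ∧ weight w α = D := by
  have h : {α | α ∈ taylorSupport f ∧ weight w α = D}.Finite :=
    (finite_weight_le hw1 hw2 D).subset fun α hα => hα.2.le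
  rw [initialSupport, dif_pos h, Set.Finite.mem_toFinset, mem_ofPred_eq]

open Classical in
lemma facePart_eq_sum {F : Set (ℝ × ℝ)} {S : Finset (ℕ × ℕ)}
    (hS : ∀ α, toPlane α ∈ F → α ∈ taylorSupport f → α ∈ S) (x : ℝ × ℝ) :
    facePart f F x = ∑ α ∈ S,
      if toPlane α ∈ F then taylorCoeff f 0 α * x.1 ^ α.1 * x.2 ^ α.2 else 0 := by
  rw [facePart, ← finsum_eq_sum_of_support_subset]
  · exact finsum_congr fun α => finsum_eq_if
  · intro α hα
    rw [Function.mem_support, ne_eq, ite_eq_right_iff, not_forall] at hα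
    obtain ⟨h1, h2⟩ := hα
    exact hS α h1 fun h => h2 (by simp [h])

lemma initialForm_eq_sum (hw1 : 0 < w.1) (hw2 : 0 < w.2) (x : ℝ × ℝ) :
    initialForm f w D x =
      ∑ α ∈ initialSupport f w D, taylorCoeff f 0 α * x.1 ^ α.1 * x.2 ^ α.2 := by
  classical
  rw [initialForm, facePart_eq_sum (S := initialSupport f w D)]
  · refine Finset.sum_congr rfl fun α hα => if_pos ?_
    exact ((mem_initialSupport hw1 hw2).1 hα).2
  · exact fun α h1 h2 => (mem_initialSupport hw1 hw2).2 ⟨h2, h1⟩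

lemma contDiff_initialForm (hw1 : 0 < w.1) (hw2 : 0 < w.2) :
    ContDiff ℝ ∞ (initialForm f w D) := by
  rw [funext (initialForm_eq_sum hw1 hw2)]
  exact ContDiff.sum fun α _ => contDiff_monomial _ _

lemma initialForm_dilate (hw1 : 0 < w.1) (hw2 : 0 < w.2) {r : ℝ} (hr : 0 < r) (x : ℝ × ℝ) :
    initialForm f w D (dilate w r x) = r ^ D * initialForm f w D x := by
  rw [initialForm_eq_sum hw1 hw2, initialForm_eq_sum hw1 hw2, Finset.mul_sum]
  refine Finset.sum_congr rfl fun α hα => ?_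
  have h := ((mem_initialSupport hw1 hw2).1 hα).2
  rw [← h, weight, Real.rpow_add hr, Real.rpow_mul hr.le, Real.rpow_mul hr.le,
    Real.rpow_natCast, Real.rpow_natCast, dilate]
  ring

/-- On a line with positive weights the second exponent determines the first one. -/
lemma snd_injOn_initialSupport (hw1 : 0 < w.1) (hw2 : 0 < w.2) :
    InjOn Prod.snd (initialSupport f w D : Set (ℕ × ℕ)) := by
  intro α hα β hβ h
  have h1 := ((mem_initialSupport hw1 hw2).1 hα).2
  have h2 := ((mem_initialSupport hw1 hw2).1 hβ).2
  rw [weight] at h1 h2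
  rw [h] at h1
  have : (α.1 : ℝ) = β.1 := mul_left_cancel₀ hw1.ne' (by linarith)
  exact Prod.ext (by exact_mod_cast this) h

lemma fst_injOn_initialSupport (hw1 : 0 < w.1) (hw2 : 0 < w.2) :
    InjOn Prod.fst (initialSupport f w D : Set (ℕ × ℕ)) := by
  intro α hα β hβ h
  have h1 := ((mem_initialSupport hw1 hw2).1 hα).2
  have h2 := ((mem_initialSupport hw1 hw2).1 hβ).2
  rw [weight] at h1 h2
  rw [h] at h1
  have : (α.2 : ℝ) = β.2 := mul_left_cancel₀ hw2.ne' (by linarith)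
  exact Prod.ext h (by exact_mod_cast this)

/-- The restriction of the initial form to the vertical line `x₁ = a`, as a polynomial. -/
noncomputable def sectionPoly (f : ℝ × ℝ → ℝ) (w : ℝ × ℝ) (D a : ℝ) : Polynomial ℝ :=
  ∑ α ∈ initialSupport f w D, Polynomial.monomial α.2 (taylorCoeff f 0 α * a ^ α.1)

lemma eval_sectionPoly (hw1 : 0 < w.1) (hw2 : 0 < w.2) (a z : ℝ) :
    (sectionPoly f w D a).eval z = initialForm f w D (a, z) := by
  rw [initialForm_eq_sum hw1 hw2, sectionPoly, Polynomial.eval_finsetSum]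
  simp

lemma coeff_sectionPoly (hw1 : 0 < w.1) (hw2 : 0 < w.2) (a : ℝ) {α : ℕ × ℕ}
    (hα : α ∈ initialSupport f w D) :
    (sectionPoly f w D a).coeff α.2 = taylorCoeff f 0 α * a ^ α.1 := by
  rw [sectionPoly, Polynomial.finsetSum_coeff, Finset.sum_eq_single α]
  · simp
  · intro β hβ hne
    rw [Polynomial.coeff_monomial, if_neg]
    exact fun h => hne (snd_injOn_initialSupport hw1 hw2 hβ hα h)
  · exact fun h => absurd hα h

lemma support_sectionPoly (hw1 : 0 < w.1) (hw2 : 0 < w.2) {a : ℝ} (ha : a ≠ 0) :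
    (sectionPoly f w D a).support = (initialSupport f w D).image Prod.snd := by
  ext j
  rw [Polynomial.mem_support_iff, Finset.mem_image]
  constructor
  · intro h
    rw [sectionPoly, Polynomial.finsetSum_coeff] at h
    obtain ⟨α, hα, h⟩ := Finset.exists_ne_zero_of_sum_ne_zero h
    rw [Polynomial.coeff_monomial] at h
    exact ⟨α, hα, by by_contra hc; exact h (if_neg hc)⟩
  · rintro ⟨α, hα, rfl⟩
    rw [coeff_sectionPoly hw1 hw2 a hα]
    exact mul_ne_zero ((mem_initialSupport hw1 hw2).1 hα).1 (pow_ne_zero _ ha)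

/-- The initial form vanishes as a function only if it has no terms. -/
lemma exists_initialForm_ne_zero (hw1 : 0 < w.1) (hw2 : 0 < w.2)
    (h : (initialSupport f w D).Nonempty) : ∃ x, initialForm f w D x ≠ 0 := by
  by_contra! hc
  have h0 : sectionPoly f w D 1 = 0 := Polynomial.funext fun z => by
    rw [eval_sectionPoly hw1 hw2, hc, Polynomial.eval_zero]
  have := support_sectionPoly (f := f) (D := D) hw1 hw2 (one_ne_zero (α := ℝ))
  rw [h0, Polynomial.support_zero] at this
  exact (h.image Prod.snd).ne_empty this.symm

/-- Along a `w`-dilation a smooth function of `w`-order at least `D` is asymptotic to its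
initial form of degree `D`. -/
theorem tendsto_initialForm (hf : ContDiffAt ℝ ∞ f 0) (hw1 : 0 < w.1) (hw2 : 0 < w.2)
    (hD : ∀ α ∈ taylorSupport f, D ≤ weight w α) {y : ℝ → ℝ × ℝ} {y₀ : ℝ × ℝ}
    (hy : Tendsto y (𝓝[>] 0) (𝓝 y₀)) :
    Tendsto (fun r => f (dilate w r (y r)) / r ^ D) (𝓝[>] 0) (𝓝 (initialForm f w D y₀)) := by
  classical
  obtain ⟨n, hn, hlow⟩ := exists_lowIndices hw1 hw2 D
  have hm : 0 < min w.1 w.2 := lt_min hw1 hw2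
  have hpos : ∀ᶠ r : ℝ in 𝓝[>] 0, 0 < r := eventually_mem_nhdsWithin
  have hlt1 : ∀ᶠ r : ℝ in 𝓝[>] 0, r < 1 := nhdsWithin_le_nhds (eventually_lt_nhds one_pos)
  have hrpow : ∀ s : ℝ, 0 < s → Tendsto (fun r : ℝ => r ^ s) (𝓝[>] 0) (𝓝 0) := by
    intro s hs
    have : Tendsto (fun r : ℝ => r ^ s) (𝓝 0) (𝓝 (0 ^ s)) :=
      (Real.continuousAt_rpow_const 0 s (Or.inr hs.le)).tendsto
    rw [Real.zero_rpow hs.ne'] at this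
    exact this.mono_left nhdsWithin_le_nhds
  have hy1 : Tendsto (fun r => (y r).1) (𝓝[>] 0) (𝓝 y₀.1) := hy.fst_nhds
  have hy2 : Tendsto (fun r => (y r).2) (𝓝[>] 0) (𝓝 y₀.2) := hy.snd_nhds
  have hdil : Tendsto (fun r => dilate w r (y r)) (𝓝[>] 0) (𝓝 0) := by
    have h1 := (hrpow _ hw1).mul hy1
    have h2 := (hrpow _ hw2).mul hy2
    rw [zero_mul] at h1 h2
    exact h1.prodMk_nhds h2
  have hnorm : (fun r => ‖dilate w r (y r)‖ ^ n) =O[𝓝[>] 0]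
      fun r : ℝ => r ^ (n * min w.1 w.2) := by
    have hyb : ∀ᶠ r in 𝓝[>] (0 : ℝ), ‖y r‖ < ‖y₀‖ + 1 :=
      hy.norm.eventually (eventually_lt_nhds (by linarith))
    refine IsBigO.of_bound ((‖y₀‖ + 1) ^ n) ?_
    filter_upwards [hpos, hlt1, hyb] with r hr hr1 hyr
    have hb : ‖dilate w r (y r)‖ ≤ (‖y₀‖ + 1) * r ^ min w.1 w.2 := by
      have e1 : r ^ w.1 ≤ r ^ min w.1 w.2 :=
        Real.rpow_le_rpow_of_exponent_ge hr hr1.le (min_le_left _ _)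
      have e2 : r ^ w.2 ≤ r ^ min w.1 w.2 :=
        Real.rpow_le_rpow_of_exponent_ge hr hr1.le (min_le_right _ _)
      have p1 := Real.rpow_pos_of_pos hr w.1
      have p2 := Real.rpow_pos_of_pos hr w.2
      have n1 := norm_fst_le (y r)
      have n2 := norm_snd_le (y r)
      rw [Prod.norm_def, max_le_iff, dilate, norm_mul, norm_mul, Real.norm_of_nonneg p1.le,
        Real.norm_of_nonneg p2.le, mul_comm, mul_comm (r ^ w.2)]
      constructor <;> gcongr <;> linarith
    rw [Real.norm_of_nonneg (by positivity), Real.norm_of_nonneg (by positivity), mul_comm (n : ℝ),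
      Real.rpow_mul hr.le, Real.rpow_natCast, ← mul_pow]
    gcongr
  have hrem : Tendsto (fun r => (f (dilate w r (y r)) - ∑ β ∈ lowIndices n, taylorCoeff f 0 β *
      (dilate w r (y r)).1 ^ β.1 * (dilate w r (y r)).2 ^ β.2) / r ^ D) (𝓝[>] 0) (𝓝 0) := by
    have h1 := ((taylor_isBigO hf n).comp_tendsto hdil).trans hnorm
    have h2 : (fun r : ℝ => r ^ (n * min w.1 w.2)) =o[𝓝[>] 0] fun r : ℝ => r ^ D := by
      rw [isLittleO_iff_tendsto']
      · refine (hrpow (n * min w.1 w.2 - D) (by linarith)).congr' ?_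
        filter_upwards [hpos] with r hr
        rw [Real.rpow_sub hr]
      · filter_upwards [hpos] with r hr h
        exact absurd h (Real.rpow_pos_of_pos hr D).ne'
    exact (h1.trans_isLittleO h2).tendsto_div_nhds_zero
  have hmain : Tendsto (fun r => (∑ β ∈ lowIndices n, taylorCoeff f 0 β *
      (dilate w r (y r)).1 ^ β.1 * (dilate w r (y r)).2 ^ β.2) / r ^ D) (𝓝[>] 0)
      (𝓝 (initialForm f w D y₀)) := by
    rw [initialForm, facePart_eq_sum (S := lowIndices n) fun α h1 _ => hlow α (le_of_eq h1)]
    simp_rw [Finset.sum_div]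
    refine tendsto_finsetSum _ fun β _ => ?_
    have heq : (fun r : ℝ => r ^ (weight w β - D) *
        (taylorCoeff f 0 β * (y r).1 ^ β.1 * (y r).2 ^ β.2)) =ᶠ[𝓝[>] 0]
        fun r => taylorCoeff f 0 β * (dilate w r (y r)).1 ^ β.1 * (dilate w r (y r)).2 ^ β.2
          / r ^ D := by
      filter_upwards [hpos] with r hr
      rw [weight, Real.rpow_sub hr, Real.rpow_add hr, Real.rpow_mul hr.le, Real.rpow_mul hr.le,
        Real.rpow_natCast, Real.rpow_natCast, dilate]
      ring
    refine Tendsto.congr' heq ?_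
    have hpoly : Tendsto (fun r => taylorCoeff f 0 β * (y r).1 ^ β.1 * (y r).2 ^ β.2) (𝓝[>] 0)
        (𝓝 (taylorCoeff f 0 β * y₀.1 ^ β.1 * y₀.2 ^ β.2)) :=
      (tendsto_const_nhds.mul (hy1.pow _)).mul (hy2.pow _)
    by_cases hβ : β ∈ taylorSupport f
    · rcases (hD β hβ).eq_or_lt with h | h
      · rw [if_pos (toPlane_mem_weightLine.2 h.symm)]
        simpa [← h] using hpoly
      · rw [if_neg fun hc => h.ne (toPlane_mem_weightLine.1 hc).symm]
        simpa using (hrpow (weight w β - D) (by linarith)).mul hpoly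
    · have : taylorCoeff f 0 β = 0 := not_not.1 hβ
      simp [this]
  have := hrem.add hmain
  rw [zero_add] at this
  refine this.congr fun r => ?_
  ring

/-- The lowest `w`-degree in the Taylor support is attained. -/
lemma exists_min_weight (hw1 : 0 < w.1) (hw2 : 0 < w.2) (h : (taylorSupport f).Nonempty) :
    ∃ α ∈ taylorSupport f, ∀ β ∈ taylorSupport f, weight w α ≤ weight w β := by
  obtain ⟨γ, hγ⟩ := h
  have hfin : {α | α ∈ taylorSupport f ∧ weight w α ≤ weight w γ}.Finite :=
    (finite_weight_le hw1 hw2 (weight w γ)).subset fun α hα => hα.2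
  obtain ⟨α, hα, hmin⟩ := hfin.exists_minimalFor (weight w) _ ⟨γ, hγ, le_rfl⟩
  refine ⟨α, hα.1, fun β hβ => ?_⟩
  rcases le_total (weight w β) (weight w γ) with h | h
  · rcases le_total (weight w α) (weight w β) with h' | h'
    · exact h'
    · exact hmin ⟨hβ, h⟩ h'
  · exact hα.2.trans h

/-- A smooth function with limits along all `w`-dilations, rescaled by `r ^ D`, has `w`-order at
least `D`, and the limit is its initial form of degree `D`. -/
theorem initialForm_of_tendsto (hf : ContDiffAt ℝ ∞ f 0) (hw1 : 0 < w.1) (hw2 : 0 < w.2)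
    {P : ℝ × ℝ → ℝ}
    (h : ∀ x, Tendsto (fun r => f (dilate w r x) / r ^ D) (𝓝[>] 0) (𝓝 (P x))) :
    (∀ α ∈ taylorSupport f, D ≤ weight w α) ∧ initialForm f w D = P := by
  have hord : ∀ α ∈ taylorSupport f, D ≤ weight w α := by
    by_contra! hc
    obtain ⟨β, hβ, hβD⟩ := hc
    obtain ⟨α, hα, hmin⟩ := exists_min_weight hw1 hw2 ⟨β, hβ⟩
    have hlt : weight w α < D := (hmin β hβ).trans_lt hβD
    obtain ⟨x, hx⟩ := exists_initialForm_ne_zero (f := f) (D := weight w α) hw1 hw2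
      ⟨α, (mem_initialSupport hw1 hw2).2 ⟨hα, rfl⟩⟩
    have h1 := tendsto_initialForm hf hw1 hw2 hmin (tendsto_const_nhds (x := x))
    have h2 : Tendsto (fun r : ℝ => r ^ (D - weight w α)) (𝓝[>] 0) (𝓝 0) := by
      have hs : 0 < D - weight w α := by linarith
      have : Tendsto (fun r : ℝ => r ^ (D - weight w α)) (𝓝 0) (𝓝 (0 ^ (D - weight w α))) :=
        (Real.continuousAt_rpow_const 0 _ (Or.inr hs.le)).tendsto
      rw [Real.zero_rpow hs.ne'] at this
      exact this.mono_left nhdsWithin_le_nhds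
    have h3 := (h x).mul h2
    rw [mul_zero] at h3
    refine hx (tendsto_nhds_unique h1 (h3.congr' ?_))
    filter_upwards [self_mem_nhdsWithin] with r (hr : 0 < r)
    rw [Real.rpow_sub hr]
    have := (Real.rpow_pos_of_pos hr D).ne'
    have := (Real.rpow_pos_of_pos hr (weight w α)).ne'
    field_simp
  exact ⟨hord, funext fun x =>
    tendsto_nhds_unique (tendsto_initialForm hf hw1 hw2 hord tendsto_const_nhds) (h x)⟩

/-! ### Order of vanishing as a growth condition -/

/-- `f` vanishes at `x` to order at least `n`, as a growth condition. -/
def VanishesTo (f : ℝ × ℝ → ℝ) (x : ℝ × ℝ) (n : ℕ) : Prop :=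
  (fun v => f (x + v)) =O[𝓝 0] fun v => ‖v‖ ^ n

lemma mixedPartial_comp_add (f : ℝ × ℝ → ℝ) (x : ℝ × ℝ) (a b : ℕ) :
    mixedPartial a b (fun v => f (x + v)) = fun v => mixedPartial a b f (x + v) := by
  induction a with
  | zero =>
    induction b generalizing f with
    | zero => rfl
    | succ b ih =>
      rw [mixedPartial_succ_right, mixedPartial_succ_right, ← ih]
      congr 1
      ext v
      simp only [partial2, fderiv_comp_add_left]
  | succ a ih =>
    rw [mixedPartial_succ_left, mixedPartial_succ_left, ih]
    ext v
    simp only [partial1, fderiv_comp_add_left]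

/-- The order of vanishing of a smooth function is its order of growth. -/
theorem le_vanishingOrder_iff {x : ℝ × ℝ} {n : ℕ} (hf : ContDiffAt ℝ ∞ f x) :
    (n : ℕ∞) ≤ vanishingOrder f x ↔ VanishesTo f x n := by
  have hiff : (n : ℕ∞) ≤ vanishingOrder f x ↔
      ∀ a b, a + b < n → mixedPartial a b f x = 0 := by
    simp only [vanishingOrder, le_iInf_iff, Nat.cast_le, Prod.forall, ne_eq,
      taylorCoeff_eq_zero_iff]
    refine forall₂_congr fun a b => ?_
    rw [← not_lt, not_imp_not]
  rw [hiff]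
  refine ⟨isBigO_of_mixedPartial_eq_zero n hf, fun h a b hab => ?_⟩
  set F : ℝ × ℝ → ℝ := fun v => f (x + v) with hF
  have hFs : ContDiffAt ℝ ∞ F 0 := by
    have : ContDiffAt ℝ ∞ f (x + 0) := by simpa using hf
    exact this.comp 0 (contDiffAt_const.add contDiffAt_id)
  have hlim : ∀ y : ℝ × ℝ, Tendsto (fun r : ℝ => F (dilate (1, 1) r y) / r ^ ((n : ℝ) - 1 / 2))
      (𝓝[>] 0) (𝓝 0) := by
    intro y
    have hpos : ∀ᶠ r : ℝ in 𝓝[>] 0, 0 < r := eventually_mem_nhdsWithin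
    have hdil : Tendsto (fun r => dilate (1, 1) r y) (𝓝[>] 0) (𝓝 0) := by
      have : Tendsto (fun r : ℝ => dilate (1, 1) r y) (𝓝 0) (𝓝 (dilate (1, 1) 0 y)) := by
        simp only [dilate, Real.rpow_one]
        exact Continuous.tendsto (by fun_prop) 0
      rw [show dilate (1, 1) 0 y = 0 by simp [dilate]] at this
      exact this.mono_left nhdsWithin_le_nhds
    have h1 : (fun r => F (dilate (1, 1) r y)) =O[𝓝[>] 0] fun r : ℝ => r ^ (n : ℝ) := by
      refine (h.comp_tendsto hdil).trans (IsBigO.of_bound (‖y‖ ^ n) ?_)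
      filter_upwards [hpos] with r hr
      have : dilate (1, 1) r y = r • y := by ext <;> simp [dilate]
      simp only [Function.comp_apply, this, Real.rpow_natCast, norm_smul, norm_pow, norm_norm,
        norm_mul, mul_pow]
      rw [mul_comm]
    have h2 : (fun r : ℝ => r ^ (n : ℝ)) =o[𝓝[>] 0] fun r : ℝ => r ^ ((n : ℝ) - 1 / 2) := by
      rw [isLittleO_iff_tendsto']
      · have ht : Tendsto (fun r : ℝ => r ^ (1 / 2 : ℝ)) (𝓝 0) (𝓝 (0 ^ (1 / 2 : ℝ))) :=
          (Real.continuousAt_rpow_const 0 _ (Or.inr (by norm_num))).tendsto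
        rw [Real.zero_rpow (by norm_num)] at ht
        refine (ht.mono_left nhdsWithin_le_nhds).congr' ?_
        filter_upwards [hpos] with r hr
        rw [← Real.rpow_sub hr]
        congr 1
        ring
      · filter_upwards [hpos] with r hr h
        exact absurd h (Real.rpow_pos_of_pos hr _).ne'
    exact (h1.trans_isLittleO h2).tendsto_div_nhds_zero
  have hord := (initialForm_of_tendsto (w := (1, 1)) hFs one_pos one_pos hlim).1 (a, b)
  by_contra hne
  have hmem : (a, b) ∈ taylorSupport F := by
    rw [taylorSupport, mem_ofPred_eq, ne_eq, taylorCoeff_eq_zero_iff, hF, mixedPartial_comp_add]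
    simpa using hne
  have := hord hmem
  rw [weight] at this
  have hab' : (a : ℝ) + b + 1 ≤ n := by exact_mod_cast hab
  simp only at this
  linarith

/-- Vanishing to order `n` is preserved by substitution of a differentiable map. -/
lemma VanishesTo.comp {G : ℝ × ℝ → ℝ × ℝ} {x : ℝ × ℝ} {n : ℕ} (h : VanishesTo f (G x) n)
    (hG : DifferentiableAt ℝ G x) : VanishesTo (f ∘ G) x n := by
  have htend : Tendsto (fun v => x + v) (𝓝 0) (𝓝 x) := by
    have : ContinuousAt (fun v => x + v) 0 := by fun_prop
    simpa [ContinuousAt] using this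
  have h1 : (fun v => G (x + v) - G x) =O[𝓝 0] fun v => v := by
    have := hG.isBigO_sub.comp_tendsto htend
    simpa [Function.comp_def] using this
  have h0 : Tendsto (fun v => G (x + v) - G x) (𝓝 0) (𝓝 0) := by
    have := (hG.continuousAt.tendsto.comp htend).sub_const (G x)
    simpa using this
  have h2 := h.comp_tendsto h0
  simp only [Function.comp_def, add_sub_cancel] at h2
  exact h2.trans (h1.norm_norm.pow n)

lemma VanishesTo.const_mul {x : ℝ × ℝ} {n : ℕ} (h : VanishesTo f x n) (c : ℝ) :
    VanishesTo (fun y => c * f y) x n := IsBigO.const_mul_left h c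

end

section

/-! ### Newton polyhedra and supporting lines -/

variable {φ : ℝ × ℝ → ℝ} {w : ℝ × ℝ} {D : ℝ}

lemma toPlane_mem_newtonPolyhedron {α : ℕ × ℕ} (hα : α ∈ taylorSupport φ) :
    toPlane α ∈ newtonPolyhedron φ := by
  refine subset_convexHull ℝ _ ?_
  simp only [mem_iUnion, exists_prop]
  exact ⟨α, hα, le_rfl, le_rfl⟩

lemma newtonPolyhedron_subset_halfPlane (hw1 : 0 ≤ w.1) (hw2 : 0 ≤ w.2)
    (hD : ∀ α ∈ taylorSupport φ, D ≤ weight w α) {t : ℝ × ℝ} (ht : t ∈ newtonPolyhedron φ) :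
    D ≤ w.1 * t.1 + w.2 * t.2 := by
  have hconv : Convex ℝ {t : ℝ × ℝ | D ≤ w.1 * t.1 + w.2 * t.2} := by
    intro x hx y hy a b ha hb hab
    simp only [mem_ofPred_eq, Prod.fst_add, Prod.snd_add, Prod.smul_fst, Prod.smul_snd,
      smul_eq_mul] at *
    have h1 := mul_le_mul_of_nonneg_left hx ha
    have h2 := mul_le_mul_of_nonneg_left hy hb
    have : D = a * D + b * D := by rw [← add_mul, hab, one_mul]
    linarith
  refine convexHull_min ?_ hconv ht
  intro z hz
  simp only [mem_iUnion, exists_prop] at hz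
  obtain ⟨α, hα, h1, h2⟩ := hz
  refine (hD α hα).trans ?_
  have := mul_le_mul_of_nonneg_left h1 hw1
  have := mul_le_mul_of_nonneg_left h2 hw2
  simp only [weight, toPlane] at *
  linarith

lemma bddBelow_diag : BddBelow {t : ℝ | ((t, t) : ℝ × ℝ) ∈ newtonPolyhedron φ} :=
  ⟨0, fun _ ht => (newtonPolyhedron_nonneg ht).1⟩

lemma diag_nonempty (hφ : (taylorSupport φ).Nonempty) :
    {t : ℝ | ((t, t) : ℝ × ℝ) ∈ newtonPolyhedron φ}.Nonempty := by
  obtain ⟨α, hα⟩ := hφ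
  exact ⟨max (α.1 : ℝ) α.2, newtonPolyhedron_upward (toPlane_mem_newtonPolyhedron hα)
    ⟨le_max_left _ _, le_max_right _ _⟩⟩

lemma newtonDistance_nonneg : 0 ≤ newtonDistance φ :=
  Real.sInf_nonneg fun _ ht => (newtonPolyhedron_nonneg ht).1

lemma newtonDistance_le {t : ℝ} (h : ((t, t) : ℝ × ℝ) ∈ newtonPolyhedron φ) :
    newtonDistance φ ≤ t := csInf_le bddBelow_diag h

lemma le_mul_newtonDistance (hφ : (taylorSupport φ).Nonempty) (hw1 : 0 ≤ w.1) (hw2 : 0 ≤ w.2)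
    (hw : 0 < w.1 + w.2) (hD : ∀ α ∈ taylorSupport φ, D ≤ weight w α) :
    D ≤ (w.1 + w.2) * newtonDistance φ := by
  rw [← div_le_iff₀' hw]
  refine le_csInf (diag_nonempty hφ) fun t ht => ?_
  have := newtonPolyhedron_subset_halfPlane hw1 hw2 hD ht
  rw [div_le_iff₀' hw]
  simp only at this
  linarith

/-- There is a supporting line of the Newton polyhedron, with nonnegative weights, through the
diagonal point `(d, d)`. -/
lemma exists_supporting_weight (hφ : (taylorSupport φ).Nonempty) :
    ∃ κ : ℝ × ℝ, 0 ≤ κ.1 ∧ 0 ≤ κ.2 ∧ κ.1 + κ.2 = 1 ∧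
      ∀ α ∈ taylorSupport φ, newtonDistance φ ≤ weight κ α := by
  set d := newtonDistance φ with hd
  have hfr : ((d, d) : ℝ × ℝ) ∈ frontier (newtonPolyhedron φ) :=
    (diag_mem_frontier_iff hφ d).2 rfl
  have hint : ((d, d) : ℝ × ℝ) ∉ interior (newtonPolyhedron φ) := hfr.2
  have hconv : Convex ℝ (newtonPolyhedron φ) := convex_convexHull ℝ _
  obtain ⟨l, hl⟩ := geometric_hahn_banach_open_point hconv.interior isOpen_interior hint
  have hgt : ∀ t : ℝ × ℝ, t ∈ newtonPolyhedron φ → ∀ ε > 0, l (t + (ε, ε)) < l (d, d) := by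
    intro t ht ε hε
    refine hl _ (mem_interior_iff_mem_nhds.2 (Metric.mem_nhds_iff.2 ⟨ε, hε, ?_⟩))
    intro z hz
    rw [Metric.mem_ball, Prod.dist_eq, max_lt_iff, Real.dist_eq, Real.dist_eq, abs_lt,
      abs_lt] at hz
    refine newtonPolyhedron_upward ht ⟨?_, ?_⟩
    · have := hz.1.1; simp only [Prod.fst_add] at *; linarith
    · have := hz.2.1; simp only [Prod.snd_add] at *; linarith
  have hlv : ∀ v : ℝ × ℝ, l v = v.1 * l (1, 0) + v.2 * l (0, 1) :=
    apply_eq_coords l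
  set p := l (1, 0)
  set q := l (0, 1)
  obtain ⟨α, hα⟩ := hφ
  have hup : ∀ s t : ℝ, 0 ≤ s → 0 ≤ t → ∀ β ∈ taylorSupport φ,
      (β.1 + s + 1) * p + (β.2 + t + 1) * q < d * p + d * q := by
    intro s t hs ht β hβ
    have hmem : toPlane β + (s, t) ∈ newtonPolyhedron φ :=
      newtonPolyhedron_upward (toPlane_mem_newtonPolyhedron hβ)
        ⟨by simpa using hs, by simpa using ht⟩
    have := hgt _ hmem 1 one_pos
    rw [hlv, hlv (d, d)] at this
    simpa [toPlane] using this
  have hp : p ≤ 0 := by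
    by_contra! hc
    set K := d * p + d * q - ((α.1 + 1) * p + (α.2 + 1) * q)
    have h0 := hup 0 0 le_rfl le_rfl α hα
    have hK : 0 ≤ K := by simp only [K]; linarith
    have := hup (K / p) 0 (by positivity) le_rfl α hα
    have e : K / p * p = K := div_mul_cancel₀ _ hc.ne'
    simp only [K] at *
    nlinarith
  have hq : q ≤ 0 := by
    by_contra! hc
    set K := d * p + d * q - ((α.1 + 1) * p + (α.2 + 1) * q)
    have h0 := hup 0 0 le_rfl le_rfl α hα
    have hK : 0 ≤ K := by simp only [K]; linarith
    have := hup 0 (K / q) le_rfl (by positivity) α hα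
    have e : K / q * q = K := div_mul_cancel₀ _ hc.ne'
    simp only [K] at *
    nlinarith
  have hpq : p + q < 0 := by
    rcases hp.lt_or_eq with h | h
    · linarith
    rcases hq.lt_or_eq with h' | h'
    · linarith
    have := hup 0 0 le_rfl le_rfl α hα
    simp [h, h'] at this
  refine ⟨(p / (p + q), q / (p + q)), div_nonneg_of_nonpos hp hpq.le,
    div_nonneg_of_nonpos hq hpq.le, by rw [← add_div, div_self hpq.ne], fun β hβ => ?_⟩
  have hle : β.1 * p + β.2 * q ≤ d * (p + q) := by
    refine le_of_forall_pos_le_add fun ε hε => ?_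
    have hs : 0 < ε / -(p + q) := div_pos hε (by linarith)
    have := hgt _ (toPlane_mem_newtonPolyhedron hβ) _ hs
    rw [hlv, hlv (d, d)] at this
    simp only [toPlane, Prod.fst_add, Prod.snd_add] at this
    have e : ε / -(p + q) * (p + q) = -ε := by
      rw [div_neg, neg_mul, div_mul_cancel₀ _ hpq.ne]
    nlinarith
  rw [weight]
  simp only
  rw [div_mul_eq_mul_div, div_mul_eq_mul_div, ← add_div, le_div_iff_of_neg hpq]
  linarith

open scoped Pointwise in
/-- The Newton polyhedron is closed: by Dickson's lemma it is the sum of the convex hull of a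
finite set and a closed quadrant. -/
lemma isClosed_newtonPolyhedron : IsClosed (newtonPolyhedron φ) := by
  set A : Set (ℕ × ℕ) := {α | Minimal (· ∈ taylorSupport φ) α} with hA
  have hfin : A.Finite :=
    WellQuasiOrderedLE.finite_of_isAntichain
      (setOfPred_minimal_antichain (· ∈ taylorSupport φ))
  have hle : ∀ β ∈ taylorSupport φ, ∃ α ∈ A, α ≤ β := by
    intro β hβ
    obtain ⟨α, h1, h2⟩ := exists_minimal_le_of_wellFoundedLT (· ∈ taylorSupport φ) β hβ
    exact ⟨α, h2, h1⟩
  have heq : (⋃ α ∈ taylorSupport φ,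
      {t : ℝ × ℝ | (toPlane α).1 ≤ t.1 ∧ (toPlane α).2 ≤ t.2}) =
        toPlane '' A + Ici (0 : ℝ × ℝ) := by
    ext t
    simp only [mem_iUnion, exists_prop, Set.mem_add, mem_image]
    constructor
    · rintro ⟨β, hβ, h1, h2⟩
      obtain ⟨α, hα, h⟩ := hle β hβ
      have e1 : (α.1 : ℝ) ≤ β.1 := by exact_mod_cast h.1
      have e2 : (α.2 : ℝ) ≤ β.2 := by exact_mod_cast h.2
      refine ⟨_, ⟨α, hα, rfl⟩, t - toPlane α, ⟨?_, ?_⟩, by simp⟩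
      · simp only [toPlane, Prod.fst_zero, Prod.fst_sub] at *; linarith
      · simp only [toPlane, Prod.snd_zero, Prod.snd_sub] at *; linarith
    · rintro ⟨_, ⟨α, hα, rfl⟩, z, hz, rfl⟩
      have h1 := hz.1
      have h2 := hz.2
      refine ⟨α, hα.1, ?_, ?_⟩
      · simpa using h1
      · simpa using h2
  rw [newtonPolyhedron, heq, convexHull_add, (convex_Ici (𝕜 := ℝ) (0 : ℝ × ℝ)).convexHull_eq]
  exact isClosed_Ici.add_left_of_isCompact ((hfin.image toPlane).isCompact_convexHull ℝ)

/-- The diagonal point `(d, d)` belongs to the Newton polyhedron. -/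
lemma diag_mem_newtonPolyhedron (hφ : (taylorSupport φ).Nonempty) :
    ((newtonDistance φ, newtonDistance φ) : ℝ × ℝ) ∈ newtonPolyhedron φ := by
  have := ((diag_mem_frontier_iff hφ _).2 rfl : _ ∈ frontier (newtonPolyhedron φ)).1
  rwa [isClosed_newtonPolyhedron.closure_eq] at this

/-- Tilting a supporting line: if the multi-indices on the line `w₁ t₁ + w₂ t₂ = D` all lie
strictly beyond the point `(s, s)` of that line in some nonnegative direction `e`, then `(s, s)`
does not belong to the Newton polyhedron and the Newton distance exceeds `s`. -/
lemma lt_newtonDistance_of_tilt (hφ : (taylorSupport φ).Nonempty) (hw1 : 0 < w.1) (hw2 : 0 < w.2)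
    (hD : ∀ α ∈ taylorSupport φ, D ≤ weight w α) {e : ℝ × ℝ} (he1 : 0 ≤ e.1) (he2 : 0 ≤ e.2)
    {s c : ℝ} (hs : (w.1 + w.2) * s = D) (hsc : (e.1 + e.2) * s < c)
    (he : ∀ α ∈ initialSupport φ w D, c ≤ weight e α) :
    s < newtonDistance φ := by
  -- the weights that exceed `D` exceed it by a definite amount `δ`
  obtain ⟨δ, hδ, hgap⟩ : ∃ δ > 0, ∀ α ∈ taylorSupport φ, weight w α ≠ D → D + δ ≤ weight w α := by
    have hfin : {α | α ∈ taylorSupport φ ∧ weight w α ≠ D ∧ weight w α ≤ D + 1}.Finite :=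
      (finite_weight_le hw1 hw2 (D + 1)).subset fun α hα => hα.2.2
    rcases Set.eq_empty_or_nonempty
      {α | α ∈ taylorSupport φ ∧ weight w α ≠ D ∧ weight w α ≤ D + 1} with h | h
    · refine ⟨1, one_pos, fun α hα hne => ?_⟩
      by_contra! hc
      exact (Set.eq_empty_iff_forall_notMem.1 h α) ⟨hα, hne, hc.le⟩
    · obtain ⟨α, hα, hmin⟩ := hfin.exists_minimalFor (weight w) _ h
      have hlt : D < weight w α := lt_of_le_of_ne (hD α hα.1) hα.2.1.symm
      refine ⟨weight w α - D, by linarith, fun β hβ hne => ?_⟩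
      rw [add_sub_cancel]
      rcases le_total (weight w β) (D + 1) with h' | h'
      · rcases le_total (weight w α) (weight w β) with h'' | h''
        · exact h''
        · exact hmin ⟨hβ, hne, h'⟩ h''
      · exact hα.2.2.trans h'
  have he0 : ∀ α, 0 ≤ weight e α := fun α => by rw [weight]; positivity
  obtain ⟨ε, hε, hεδ⟩ : ∃ ε > 0, ε * ((e.1 + e.2) * s) < δ := by
    refine ⟨δ / (|(e.1 + e.2) * s| + 1), by positivity, ?_⟩
    rw [div_mul_eq_mul_div, div_lt_iff₀ (by positivity)]
    have := le_abs_self ((e.1 + e.2) * s)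
    nlinarith
  have hmin : ∀ α ∈ taylorSupport φ,
      D + min (ε * c) δ ≤ weight (w.1 + ε * e.1, w.2 + ε * e.2) α := by
    intro α hα
    have hsplit : weight (w.1 + ε * e.1, w.2 + ε * e.2) α = weight w α + ε * weight e α := by
      simp only [weight]; ring
    rw [hsplit]
    by_cases h : weight w α = D
    · have := mul_le_mul_of_nonneg_left
        (he α ((mem_initialSupport hw1 hw2).2 ⟨hα, h⟩)) hε.le
      linarith [min_le_left (ε * c) δ]
    · have := hgap α hα h
      have := mul_nonneg hε.le (he0 α)
      linarith [min_le_right (ε * c) δ]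
  have h1 : 0 ≤ ε * e.1 := by positivity
  have h2 : 0 ≤ ε * e.2 := by positivity
  have hkey := le_mul_newtonDistance (w := (w.1 + ε * e.1, w.2 + ε * e.2)) hφ
    (by simp only; linarith) (by simp only; linarith) (by simp only; linarith) hmin
  simp only at hkey
  have hlt : ε * ((e.1 + e.2) * s) < min (ε * c) δ :=
    lt_min (mul_lt_mul_of_pos_left hsc hε) hεδ
  have hpos : 0 < w.1 + ε * e.1 + (w.2 + ε * e.2) := by linarith
  refine lt_of_mul_lt_mul_left ?_ hpos.le
  calc (w.1 + ε * e.1 + (w.2 + ε * e.2)) * s = D + ε * ((e.1 + e.2) * s) := by rw [← hs]; ring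
    _ < _ := by linarith

/-! ### Coordinate swap -/

lemma partial1_comp_swap (f : ℝ × ℝ → ℝ) : partial1 (f ∘ Prod.swap) = partial2 f ∘ Prod.swap := by
  ext x
  have h := (ContinuousLinearEquiv.prodComm ℝ ℝ ℝ).comp_right_fderiv (f := f) (x := x)
  have := congrArg (fun L : ℝ × ℝ →L[ℝ] ℝ => L (1, 0)) h
  exact this

lemma partial2_comp_swap (f : ℝ × ℝ → ℝ) : partial2 (f ∘ Prod.swap) = partial1 f ∘ Prod.swap := by
  ext x
  have h := (ContinuousLinearEquiv.prodComm ℝ ℝ ℝ).comp_right_fderiv (f := f) (x := x)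
  have := congrArg (fun L : ℝ × ℝ →L[ℝ] ℝ => L (0, 1)) h
  exact this

lemma contDiff_swap : ContDiff ℝ ∞ (Prod.swap : ℝ × ℝ → ℝ × ℝ) :=
  contDiff_snd.prodMk contDiff_fst

lemma smooth_comp_swap {f : ℝ × ℝ → ℝ} (hf : ContDiffAt ℝ ∞ f 0) :
    ContDiffAt ℝ ∞ (f ∘ Prod.swap) 0 := by
  have : ContDiffAt ℝ ∞ f (Prod.swap 0) := hf
  exact this.comp 0 contDiff_swap.contDiffAt

lemma taylorCoeff_comp_swap {f : ℝ × ℝ → ℝ} (hf : ContDiffAt ℝ ∞ f 0) (α : ℕ × ℕ) :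
    taylorCoeff (f ∘ Prod.swap) 0 α = taylorCoeff f 0 α.swap := by
  have key : ∀ a b, mixedPartial a b (f ∘ Prod.swap) =ᶠ[𝓝 0] mixedPartial b a f ∘ Prod.swap := by
    have hsw : Tendsto (Prod.swap : ℝ × ℝ → ℝ × ℝ) (𝓝 0) (𝓝 0) := by
      have := (continuous_swap (X := ℝ) (Y := ℝ)).tendsto 0
      simpa using this
    intro a b
    induction a with
    | zero =>
      refine Eventually.of_forall fun x => ?_
      suffices h : mixedPartial 0 b (f ∘ Prod.swap) = mixedPartial b 0 f ∘ Prod.swap from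
        congrFun h x
      induction b with
      | zero => rfl
      | succ b ih =>
        rw [show mixedPartial 0 (b + 1) (f ∘ Prod.swap)
          = partial2 (mixedPartial 0 b (f ∘ Prod.swap)) from Function.iterate_succ_apply' _ _ _,
          ih, partial2_comp_swap, mixedPartial_succ_left]
    | succ a ih =>
      rw [mixedPartial_succ_left]
      refine (partial1_congr ih).trans ?_
      rw [partial1_comp_swap]
      exact hsw.eventually (mixedPartial_partial2 hf b a)
  rw [taylorCoeff_eq, taylorCoeff_eq, (key α.1 α.2).eq_of_nhds]
  simp only [Function.comp_apply, Prod.swap_zero, Prod.fst_swap, Prod.snd_swap]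
  rw [mul_comm]

lemma mem_taylorSupport_comp_swap {f : ℝ × ℝ → ℝ} (hf : ContDiffAt ℝ ∞ f 0) {α : ℕ × ℕ} :
    α ∈ taylorSupport (f ∘ Prod.swap) ↔ α.swap ∈ taylorSupport f := by
  simp only [taylorSupport, mem_ofPred_eq, taylorCoeff_comp_swap hf]

lemma weight_swap (w : ℝ × ℝ) (α : ℕ × ℕ) : weight w.swap α.swap = weight w α := by
  simp only [weight, Prod.fst_swap, Prod.snd_swap]; ring

lemma initialForm_comp_swap {f : ℝ × ℝ → ℝ} (hf : ContDiffAt ℝ ∞ f 0) {w : ℝ × ℝ} {D : ℝ}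
    (hw1 : 0 < w.1) (hw2 : 0 < w.2) (x : ℝ × ℝ) :
    initialForm (f ∘ Prod.swap) w D x = initialForm f w.swap D x.swap := by
  rw [initialForm_eq_sum hw1 hw2, initialForm_eq_sum (w := w.swap) hw2 hw1]
  refine Finset.sum_bij' (fun α _ => α.swap) (fun α _ => α.swap) ?_ ?_ ?_ ?_ ?_
  · intro α hα
    rw [mem_initialSupport hw1 hw2, mem_taylorSupport_comp_swap hf] at hα
    rw [mem_initialSupport (w := w.swap) hw2 hw1, weight_swap]
    exact hα
  · intro α hα
    rw [mem_initialSupport (w := w.swap) hw2 hw1] at hα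
    rw [mem_initialSupport hw1 hw2, mem_taylorSupport_comp_swap hf, ← weight_swap]
    simpa using hα
  · simp
  · simp
  · intro α _
    rw [taylorCoeff_comp_swap hf]
    simp only [Prod.fst_swap, Prod.snd_swap]
    ring

end

section

/-! ### Multiplicities of roots of sparse polynomials -/

/-- A nonzero real root of a polynomial has multiplicity less than the number of terms. -/
theorem lt_card_support_of_pow_dvd {Q : Polynomial ℝ} {b : ℝ} {n : ℕ} (hQ : Q ≠ 0) (hb : b ≠ 0)
    (h : (Polynomial.X - Polynomial.C b) ^ n ∣ Q) : n < Q.support.card := by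
  induction n generalizing Q with
  | zero => exact Finset.card_pos.2 (Polynomial.support_nonempty.2 hQ)
  | succ n ih =>
    -- split off the largest power of `X`
    obtain ⟨R, hR, hXR⟩ := Polynomial.exists_eq_pow_rootMultiplicity_mul_and_not_dvd Q hQ 0
    rw [Polynomial.C_0, sub_zero] at hR hXR
    set m := Polynomial.rootMultiplicity 0 Q
    have hR0 : R.coeff 0 ≠ 0 := fun h0 => hXR (Polynomial.X_dvd_iff.2 h0)
    have hcop : IsCoprime ((Polynomial.X - Polynomial.C b) ^ (n + 1)) (Polynomial.X ^ m) := by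
      have := Polynomial.isCoprime_X_sub_C_of_isUnit_sub (R := ℝ) (a := b) (b := 0)
        (by simpa using hb)
      rw [Polynomial.C_0, sub_zero] at this
      exact this.pow
    have hdvd : (Polynomial.X - Polynomial.C b) ^ (n + 1) ∣ R := by
      rw [hR] at h
      exact hcop.dvd_of_dvd_mul_left h
    have hcard : R.support.card ≤ Q.support.card := by
      refine Finset.card_le_card_of_injOn (· + m) ?_ (add_left_injective m).injOn
      intro j hj
      rw [Finset.mem_coe, Polynomial.mem_support_iff] at *
      rw [hR, Polynomial.coeff_X_pow_mul]
      exact hj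
    have hder : (Polynomial.X - Polynomial.C b) ^ n ∣ Polynomial.derivative R := by
      simpa using Polynomial.pow_sub_one_dvd_derivative_of_pow_dvd hdvd
    have hder0 : Polynomial.derivative R ≠ 0 := by
      intro h0
      have hC := Polynomial.eq_C_of_natDegree_eq_zero
        (Polynomial.derivative_eq_zero.1 h0)
      have hroot : R.eval b = 0 := by
        rw [← Polynomial.IsRoot.def, ← Polynomial.dvd_iff_isRoot]
        exact (dvd_pow_self _ n.succ_ne_zero).trans hdvd
      rw [hC, Polynomial.eval_C] at hroot
      exact hR0 hroot
    have hlt := ih hder0 hder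
    have hsub : (Polynomial.derivative R).support ⊆ (R.support.erase 0).image (· - 1) := by
      intro j hj
      rw [Polynomial.mem_support_iff, Polynomial.coeff_derivative] at hj
      rw [Finset.mem_image]
      exact ⟨j + 1, Finset.mem_erase.2 ⟨j.succ_ne_zero,
        Polynomial.mem_support_iff.2 (left_ne_zero_of_mul hj)⟩, rfl⟩
    have hle := (Finset.card_le_card hsub).trans Finset.card_image_le
    rw [Finset.card_erase_of_mem (Polynomial.mem_support_iff.2 hR0)] at hle
    omega

lemma pow_dvd_of_isBigO {Q : Polynomial ℝ} {b : ℝ} {n : ℕ}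
    (h : (fun z => Q.eval (b + z)) =O[𝓝 0] fun z : ℝ => z ^ n) :
    (Polynomial.X - Polynomial.C b) ^ n ∣ Q := by
  rcases eq_or_ne Q 0 with rfl | hQ
  · exact dvd_zero _
  obtain ⟨R, hR, hXR⟩ := Polynomial.exists_eq_pow_rootMultiplicity_mul_and_not_dvd Q hQ b
  set m := Polynomial.rootMultiplicity b Q
  have hRb : R.eval b ≠ 0 := fun h0 => hXR (Polynomial.dvd_iff_isRoot.2 h0)
  suffices hnm : n ≤ m by
    rw [hR]
    exact Dvd.dvd.mul_right (pow_dvd_pow _ hnm) _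
  by_contra! hlt
  have heq : (fun z => Q.eval (b + z)) = fun z => z ^ m * R.eval (b + z) := by
    ext z
    conv_lhs => rw [hR]
    simp
  rw [heq] at h
  have ho : (fun z : ℝ => z ^ n) =o[𝓝 0] fun z : ℝ => z ^ m := isLittleO_pow_pow hlt
  have h1 := (h.trans_isLittleO ho).tendsto_div_nhds_zero
  have h2 : Tendsto (fun z => R.eval (b + z)) (𝓝[≠] 0) (𝓝 (R.eval b)) := by
    have : Tendsto (fun z => R.eval (b + z)) (𝓝 0) (𝓝 (R.eval (b + 0))) :=
      Continuous.tendsto (by fun_prop) 0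
    rw [add_zero] at this
    exact this.mono_left nhdsWithin_le_nhds
  refine hRb (tendsto_nhds_unique h2 ((h1.mono_left nhdsWithin_le_nhds).congr' ?_))
  filter_upwards [self_mem_nhdsWithin] with z (hz : z ≠ 0)
  exact mul_div_cancel_left₀ _ (pow_ne_zero _ hz)

variable {φ : ℝ × ℝ → ℝ} {w : ℝ × ℝ} {D : ℝ} {n : ℕ}

/-- The growth of an initial form along a vertical line. -/
lemma isBigO_section {f : ℝ × ℝ → ℝ} {a b : ℝ} (h : VanishesTo f (a, b) n) :
    (fun z : ℝ => f (a, b + z)) =O[𝓝 0] fun z : ℝ => z ^ n := by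
  have ht : Tendsto (fun z : ℝ => ((0, z) : ℝ × ℝ)) (𝓝 0) (𝓝 0) :=
    Continuous.tendsto' (by fun_prop) _ _ rfl
  have h1 := h.comp_tendsto ht
  have h2 : (fun z : ℝ => f (a, b + z)) =O[𝓝 0] fun z : ℝ => ‖((0, z) : ℝ × ℝ)‖ ^ n := by
    simpa [Function.comp_def] using h1
  refine h2.trans (IsBigO.of_bound 1 (Eventually.of_forall fun z => ?_))
  simp [Prod.norm_def]

lemma pow_dvd_sectionPoly (hw1 : 0 < w.1) (hw2 : 0 < w.2) {a b : ℝ}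
    (h : VanishesTo (initialForm φ w D) (a, b) n) :
    (Polynomial.X - Polynomial.C b) ^ n ∣ sectionPoly φ w D a := by
  refine pow_dvd_of_isBigO ?_
  simp only [eval_sectionPoly hw1 hw2]
  exact isBigO_section h

/-- An initial form that vanishes to order `n` off the axes has more than `n` terms. -/
theorem lt_card_initialSupport (hw1 : 0 < w.1) (hw2 : 0 < w.2) {a b : ℝ} (ha : a ≠ 0) (hb : b ≠ 0)
    (hne : (initialSupport φ w D).Nonempty) (h : VanishesTo (initialForm φ w D) (a, b) n) :
    n < (initialSupport φ w D).card := by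
  have hsupp := support_sectionPoly (f := φ) (D := D) hw1 hw2 ha
  have hQ : sectionPoly φ w D a ≠ 0 := by
    rw [← Polynomial.support_nonempty, hsupp]
    exact hne.image _
  have := lt_card_support_of_pow_dvd hQ hb (pow_dvd_sectionPoly hw1 hw2 h)
  rwa [hsupp, Finset.card_image_of_injOn (snd_injOn_initialSupport hw1 hw2)] at this

lemma exists_le_of_lt_card {ι : Type*} {S : Finset ι} {g : ι → ℕ} (hg : InjOn g (S : Set ι))
    (hn : n < S.card) : ∃ α ∈ S, n ≤ g α := by
  by_contra! hc
  have : S.card ≤ (Finset.range n).card :=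
    Finset.card_le_card_of_injOn g (fun α hα => by simpa using hc α hα) hg
  rw [Finset.card_range] at this
  omega

/-- If an initial form of low degree has many terms, their exponents lie on both sides of the
diagonal. -/
lemma exists_both_sides (hw1 : 0 < w.1) (hw2 : 0 < w.2) {d : ℝ} (hD : D ≤ (w.1 + w.2) * d)
    (hdn : d < n) (hn : n < (initialSupport φ w D).card) :
    (∃ α ∈ initialSupport φ w D, α.2 < α.1) ∧ ∃ α ∈ initialSupport φ w D, α.1 < α.2 := by
  have key : ∀ α ∈ initialSupport φ w D, n ≤ α.1 → n ≤ α.2 → False := by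
    intro α hα h1 h2
    have h := ((mem_initialSupport hw1 hw2).1 hα).2
    rw [weight] at h
    have e1 : d < (α.1 : ℝ) := hdn.trans_le (by exact_mod_cast h1)
    have e2 : d < (α.2 : ℝ) := hdn.trans_le (by exact_mod_cast h2)
    nlinarith
  constructor
  · by_contra! hc
    obtain ⟨α, hα, h⟩ := exists_le_of_lt_card (fst_injOn_initialSupport hw1 hw2) hn
    exact key α hα h (h.trans (hc α hα))
  · by_contra! hc
    obtain ⟨α, hα, h⟩ := exists_le_of_lt_card (snd_injOn_initialSupport hw1 hw2) hn
    exact key α hα (h.trans (hc α hα)) h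

/-- Natural numbers in a fixed residue class modulo `p`: if there are more than `n` of them, one
is at least `p * n`. -/
lemma exists_mul_le_of_lt_card {ι : Type*} {S : Finset ι} {g : ι → ℕ} {p : ℕ}
    (hg : InjOn g (S : Set ι)) (hmod : ∀ α ∈ S, ∀ β ∈ S, g α % p = g β % p)
    (hn : n < S.card) : ∃ α ∈ S, p * n ≤ g α := by
  have hinj : InjOn (fun α => g α / p) (S : Set ι) := by
    intro α hα β hβ h
    refine hg hα hβ ?_
    rw [← Nat.div_add_mod (g α) p, ← Nat.div_add_mod (g β) p, hmod α hα β hβ]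
    simp only at h
    rw [h]
  obtain ⟨α, hα, h⟩ := exists_le_of_lt_card hinj hn
  exact ⟨α, hα, (Nat.mul_le_mul_left p h).trans (Nat.mul_div_le _ _)⟩

/-- If the initial form of degree `(w₁ + w₂) d` has more than `n > d` terms, then one of the
weights is an integer multiple of the other one. -/
theorem exists_nat_weight_ratio (hw1 : 0 < w.1) (hw2 : 0 < w.2) {d : ℝ} (hd : 0 ≤ d)
    (hD : D = (w.1 + w.2) * d) (hdn : d < n) (hn : n < (initialSupport φ w D).card) :
    ∃ k : ℕ, 1 ≤ k ∧ (w.2 = k * w.1 ∨ w.1 = k * w.2) := by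
  have hn0 : 0 < n := by
    have : (0 : ℝ) < n := hd.trans_lt hdn
    exact_mod_cast this
  obtain ⟨⟨α, hα, hα21⟩, ⟨β, hβ, hβ12⟩⟩ := exists_both_sides hw1 hw2 hD.le hdn hn
  have hmem : ∀ γ ∈ initialSupport φ w D, w.1 * γ.1 + w.2 * γ.2 = D :=
    fun γ hγ => ((mem_initialSupport hw1 hw2).1 hγ).2
  -- coprime `p`, `q` with `w₁ q = w₂ p`
  obtain ⟨p, q, hp, hq, hcop, hpq⟩ : ∃ p q : ℕ, 0 < p ∧ 0 < q ∧ Nat.Coprime p q ∧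
      w.1 * q = w.2 * p := by
    have e1 := hmem α hα
    have e2 := hmem β hβ
    have c1 : (α.2 : ℝ) + 1 ≤ α.1 := by exact_mod_cast hα21
    have c2 : (β.1 : ℝ) + 1 ≤ β.2 := by exact_mod_cast hβ12
    have hx : β.1 < α.1 := by
      by_contra! hc
      have c3 : (α.1 : ℝ) ≤ β.1 := by exact_mod_cast hc
      have c4 : (α.2 : ℝ) < β.2 := by linarith
      nlinarith
    have hy : α.2 < β.2 := by
      by_contra! hc
      have c3 : (β.2 : ℝ) ≤ α.2 := by exact_mod_cast hc
      have c4 : (β.1 : ℝ) < α.1 := by linarith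
      nlinarith
    set X := α.1 - β.1 with hX
    set Y := β.2 - α.2 with hY
    have hXY : w.1 * X = w.2 * Y := by
      rw [hX, hY, Nat.cast_sub hx.le, Nat.cast_sub hy.le]
      linarith
    have hXpos : 0 < X := by omega
    have hYpos : 0 < Y := by omega
    obtain ⟨g, p, q, hg, hcop, hYp, hXq⟩ := Nat.exists_coprime' (Nat.gcd_pos_of_pos_left X hYpos)
    refine ⟨p, q, Nat.pos_of_ne_zero ?_, Nat.pos_of_ne_zero ?_, hcop, ?_⟩
    · rintro rfl; omega
    · rintro rfl; omega
    · rw [hYp, hXq] at hXY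
      push_cast at hXY
      have hg' : (g : ℝ) ≠ 0 := by positivity
      refine mul_right_cancel₀ hg' ?_
      linarith
  have hp' : (0 : ℝ) < p := by exact_mod_cast hp
  have hq' : (0 : ℝ) < q := by exact_mod_cast hq
  have hline : ∀ γ ∈ initialSupport φ w D, ∀ δ ∈ initialSupport φ w D,
      (p : ℤ) * γ.1 + q * γ.2 = p * δ.1 + q * δ.2 := by
    intro γ hγ δ hδ
    have e1 := hmem γ hγ
    have e2 := hmem δ hδ
    have : (p : ℝ) * γ.1 + q * γ.2 = p * δ.1 + q * δ.2 := by
      refine mul_left_cancel₀ hw1.ne' ?_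
      calc w.1 * (p * γ.1 + q * γ.2) = p * (w.1 * γ.1) + (w.1 * q) * γ.2 := by ring
        _ = p * (w.1 * γ.1 + w.2 * γ.2) := by rw [hpq]; ring
        _ = p * (w.1 * δ.1 + w.2 * δ.2) := by rw [e1, e2]
        _ = p * (w.1 * δ.1) + (w.1 * q) * δ.2 := by rw [hpq]; ring
        _ = _ := by ring
    exact_mod_cast this
  have hmod2 : ∀ γ ∈ initialSupport φ w D, ∀ δ ∈ initialSupport φ w D, γ.2 % p = δ.2 % p := by
    intro γ hγ δ hδ
    have h := hline γ hγ δ hδ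
    refine (Nat.modEq_iff_dvd.2 ?_ : γ.2 ≡ δ.2 [MOD p])
    have hd : (p : ℤ) ∣ q * ((δ.2 : ℤ) - γ.2) := ⟨γ.1 - δ.1, by linarith⟩
    exact (Int.isCoprime_iff_gcd_eq_one.2 (by simpa using hcop)).dvd_of_dvd_mul_left hd
  have hmod1 : ∀ γ ∈ initialSupport φ w D, ∀ δ ∈ initialSupport φ w D, γ.1 % q = δ.1 % q := by
    intro γ hγ δ hδ
    have h := hline γ hγ δ hδ
    refine (Nat.modEq_iff_dvd.2 ?_ : γ.1 ≡ δ.1 [MOD q])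
    have hd : (q : ℤ) ∣ p * ((δ.1 : ℤ) - γ.1) := ⟨γ.2 - δ.2, by linarith⟩
    exact (Int.isCoprime_iff_gcd_eq_one.2 (by simpa using hcop.symm)).dvd_of_dvd_mul_left hd
  obtain ⟨γ, hγ, hγn⟩ := exists_mul_le_of_lt_card (snd_injOn_initialSupport hw1 hw2) hmod2 hn
  -- the term with the highest power of `x₂` forces `p q < p + q`
  have hlt : p * q < p + q := by
    have e := hmem γ hγ
    have c1 : (p : ℝ) * n ≤ γ.2 := by exact_mod_cast hγn
    have c2 : w.2 * (p * n) ≤ (w.1 + w.2) * d := by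
      have : 0 ≤ w.1 * γ.1 := by positivity
      have := mul_le_mul_of_nonneg_left c1 hw2.le
      linarith
    have c3 : w.2 * (p * n) < (w.1 + w.2) * n :=
      c2.trans_lt (mul_lt_mul_of_pos_left hdn (by linarith))
    have hn' : (0 : ℝ) < n := by exact_mod_cast hn0
    have c4 : w.2 * p < w.1 + w.2 := by
      refine lt_of_mul_lt_mul_right ?_ hn'.le
      linarith
    have c5 : w.2 * (p * q) < w.2 * (p + q) := by
      calc w.2 * (p * q) = (w.2 * p) * q := by ring
        _ < (w.1 + w.2) * q := mul_lt_mul_of_pos_right c4 hq'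
        _ = w.2 * (p + q) := by rw [add_mul, hpq]; ring
    exact_mod_cast lt_of_mul_lt_mul_left c5 hw2.le
  have h1 : p = 1 ∨ q = 1 := by
    by_contra! hc
    have h2p : 2 ≤ p := by omega
    have h2q : 2 ≤ q := by omega
    nlinarith
  rcases h1 with rfl | rfl
  · exact ⟨q, hq, Or.inl (by rw [Nat.cast_one, mul_one] at hpq; linarith)⟩
  · exact ⟨p, hp, Or.inr (by rw [Nat.cast_one, mul_one] at hpq; linarith)⟩

end

section

/-! ### Initial forms under changes of coordinates -/

variable {φ : ℝ × ℝ → ℝ} {ψ : ℝ × ℝ → ℝ × ℝ} {w : ℝ × ℝ} {D d : ℝ} {n : ℕ}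

/-- If `ψ` respects the `w`-dilations to first order, with quasi-homogeneous first order part `g`,
then composition with `ψ` acts on initial forms as composition with `g`. -/
theorem initialForm_comp (hφ : ContDiffAt ℝ ∞ φ 0) (hψ : ContDiffAt ℝ ∞ ψ 0) (hψ0 : ψ 0 = 0)
    (hw1 : 0 < w.1) (hw2 : 0 < w.2) (hD : ∀ α ∈ taylorSupport φ, D ≤ weight w α)
    {g : ℝ × ℝ → ℝ × ℝ}
    (hg1 : ∀ x, Tendsto (fun r => (ψ (dilate w r x)).1 / r ^ w.1) (𝓝[>] 0) (𝓝 (g x).1))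
    (hg2 : ∀ x, Tendsto (fun r => (ψ (dilate w r x)).2 / r ^ w.2) (𝓝[>] 0) (𝓝 (g x).2)) :
    (∀ α ∈ taylorSupport (φ ∘ ψ), D ≤ weight w α) ∧
      initialForm (φ ∘ ψ) w D = initialForm φ w D ∘ g := by
  have hs : ContDiffAt ℝ ∞ (φ ∘ ψ) 0 := by
    have : ContDiffAt ℝ ∞ φ (ψ 0) := by rwa [hψ0]
    exact this.comp 0 hψ
  refine initialForm_of_tendsto hs hw1 hw2 fun x => ?_
  have h := tendsto_initialForm hφ hw1 hw2 hD (y₀ := g x) ((hg1 x).prodMk_nhds (hg2 x))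
  refine h.congr' ?_
  filter_upwards [self_mem_nhdsWithin] with r (hr : 0 < r)
  have e1 := (Real.rpow_pos_of_pos hr w.1).ne'
  have e2 := (Real.rpow_pos_of_pos hr w.2).ne'
  have : dilate w r ((ψ (dilate w r x)).1 / r ^ w.1, (ψ (dilate w r x)).2 / r ^ w.2)
      = ψ (dilate w r x) := by
    ext
    · simp only [dilate]; field_simp
    · simp only [dilate]; field_simp
  rw [this, Function.comp_apply]

lemma initialForm_fst_component {f : ℝ × ℝ → ℝ} {s : ℝ} (hs : 1 ≤ s) (x : ℝ × ℝ) :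
    initialForm f (1, s) 1 x = taylorCoeff f 0 (1, 0) * x.1 +
      (if s = 1 then taylorCoeff f 0 (0, 1) else 0) * x.2 := by
  classical
  rw [initialForm, facePart_eq_sum (S := {(1, 0), (0, 1)})]
  · rw [Finset.sum_pair (by simp)]
    by_cases h : s = 1 <;> simp [toPlane_mem_weightLine, weight, h]
  · rintro ⟨i, j⟩ h -
    rw [toPlane_mem_weightLine, weight] at h
    simp only [one_mul] at h
    simp only [Finset.mem_insert, Finset.mem_singleton, Prod.mk.injEq]
    rcases Nat.eq_zero_or_pos j with rfl | hj
    · left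
      simp only [Nat.cast_zero, mul_zero, add_zero] at h
      exact ⟨by exact_mod_cast h, rfl⟩
    · right
      have hj1 : (1 : ℝ) ≤ j := by exact_mod_cast hj
      have hi0 : (0 : ℝ) ≤ i := Nat.cast_nonneg i
      have e1 : (j : ℝ) ≤ s * j := by nlinarith
      have e2 : (i : ℝ) = 0 := by linarith
      have e3 : (j : ℝ) = 1 := by linarith
      exact ⟨by exact_mod_cast e2, by exact_mod_cast e3⟩

lemma initialForm_snd_component {f : ℝ × ℝ → ℝ} {s : ℝ} (hs : 1 ≤ s) (x : ℝ × ℝ) :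
    initialForm f (1, s) s x = taylorCoeff f 0 (0, 1) * x.2 +
      (if (⌊s⌋₊ : ℝ) = s then taylorCoeff f 0 (⌊s⌋₊, 0) else 0) * x.1 ^ ⌊s⌋₊ := by
  classical
  rw [initialForm, facePart_eq_sum (S := {(0, 1), (⌊s⌋₊, 0)})]
  · rw [Finset.sum_pair (by simp)]
    by_cases h : (⌊s⌋₊ : ℝ) = s
    · simp [toPlane_mem_weightLine, weight, h]
    · simp [toPlane_mem_weightLine, weight, h]
  · rintro ⟨i, j⟩ h -
    rw [toPlane_mem_weightLine, weight] at h
    simp only [one_mul] at h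
    simp only [Finset.mem_insert, Finset.mem_singleton, Prod.mk.injEq]
    rcases Nat.eq_zero_or_pos j with rfl | hj
    · right
      simp only [Nat.cast_zero, mul_zero, add_zero] at h
      rw [← h]
      simp
    · left
      have hj1 : (1 : ℝ) ≤ j := by exact_mod_cast hj
      have hi0 : (0 : ℝ) ≤ i := Nat.cast_nonneg i
      have e1 : s ≤ s * j := by nlinarith
      have e2 : (i : ℝ) = 0 := by linarith
      have e3 : (j : ℝ) = 1 := by
        refine mul_left_cancel₀ (by linarith : s ≠ 0) ?_
        linarith
      exact ⟨by exact_mod_cast e2, by exact_mod_cast e3⟩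

lemma vanishesTo_initialForm {f : ℝ × ℝ → ℝ} (hw1 : 0 < w.1) (hw2 : 0 < w.2)
    (h : ∀ α ∈ initialSupport f w D, n ≤ α.2) (a : ℝ) :
    VanishesTo (initialForm f w D) (a, 0) n := by
  rw [VanishesTo]
  simp only [initialForm_eq_sum hw1 hw2]
  refine IsBigO.fun_sum fun α hα => ?_
  have h1 : (fun v : ℝ × ℝ => taylorCoeff f 0 α * (a + v.1) ^ α.1 * v.2 ^ (α.2 - n))
      =O[𝓝 0] fun _ => (1 : ℝ) :=
    (Continuous.tendsto (by fun_prop) 0).isBigO_one ℝ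
  have h2 : (fun v : ℝ × ℝ => v.2 ^ n) =O[𝓝 0] fun v => ‖v‖ ^ n := by
    refine IsBigO.of_bound 1 (Eventually.of_forall fun v => ?_)
    rw [one_mul, norm_pow, norm_pow, norm_norm]
    exact pow_le_pow_left₀ (norm_nonneg _) (norm_snd_le v) n
  have h3 := h1.mul h2
  simp only [one_mul] at h3
  refine h3.congr_left fun v => ?_
  rw [mul_assoc, ← pow_add, Nat.sub_add_cancel (h α hα)]
  simp

/-- All initial forms of `φ` have `w`-degree at most `(w₁ + w₂) d`, and off the coordinate axes
they vanish to order less than `n`. -/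
structure InitialFormBound (φ : ℝ × ℝ → ℝ) (d : ℝ) (n : ℕ) : Prop where
  degree : ∀ (w : ℝ × ℝ) (D : ℝ), 0 < w.1 → 0 < w.2 →
    (∀ α ∈ taylorSupport φ, D ≤ weight w α) → D ≤ (w.1 + w.2) * d
  order : ∀ (w : ℝ × ℝ) (D a b : ℝ), 0 < w.1 → 0 < w.2 → a ≠ 0 → b ≠ 0 →
    (∀ α ∈ taylorSupport φ, D ≤ weight w α) → (initialSupport φ w D).Nonempty →
    ¬ VanishesTo (initialForm φ w D) (a, b) n

lemma InitialFormBound.comp_swap (hφ : ContDiffAt ℝ ∞ φ 0) (h : InitialFormBound φ d n) :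
    InitialFormBound (φ ∘ Prod.swap) d n := by
  have hord : ∀ (w : ℝ × ℝ) (D : ℝ), (∀ α ∈ taylorSupport (φ ∘ Prod.swap), D ≤ weight w α) →
      ∀ α ∈ taylorSupport φ, D ≤ weight w.swap α := by
    intro w D hD α hα
    have := hD α.swap ((mem_taylorSupport_comp_swap hφ).2 (by simpa using hα))
    rwa [← weight_swap, Prod.swap_swap] at this
  constructor
  · intro w D hw1 hw2 hD
    have := h.degree w.swap D hw2 hw1 (hord w D hD)
    rwa [Prod.fst_swap, Prod.snd_swap, add_comm] at this
  · intro w D a b hw1 hw2 ha hb hD hne hv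
    have hne' : (initialSupport φ w.swap D).Nonempty := by
      obtain ⟨α, hα⟩ := hne
      rw [mem_initialSupport hw1 hw2, mem_taylorSupport_comp_swap hφ, ← weight_swap] at hα
      exact ⟨α.swap, (mem_initialSupport (w := w.swap) hw2 hw1).2 hα⟩
    refine h.order w.swap D b a hw2 hw1 hb ha (hord w D hD) hne' ?_
    rw [show ((a, b) : ℝ × ℝ) = Prod.swap (b, a) from rfl] at hv
    have := hv.comp (contDiff_swap.differentiable (by simp)).differentiableAt
    refine this.congr_left fun v => ?_
    rw [Function.comp_apply, initialForm_comp_swap hφ hw1 hw2, Prod.swap_swap]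

/-- The Jacobian matrix of `ψ` at the origin is invertible. -/
def JacobianNeZero (ψ : ℝ × ℝ → ℝ × ℝ) : Prop :=
  taylorCoeff (fun x => (ψ x).1) 0 (1, 0) * taylorCoeff (fun x => (ψ x).2) 0 (0, 1) -
    taylorCoeff (fun x => (ψ x).1) 0 (0, 1) * taylorCoeff (fun x => (ψ x).2) 0 (1, 0) ≠ 0

/-- The quasi-homogeneous map `(u, v) ↦ (a u + e v, b v + h u ^ m)` has a smooth inverse, if it is
linear and invertible or if it is triangular. -/
lemma exists_quasihomogeneous_inverse {a b e h : ℝ} {m : ℕ}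
    (hcase : (m = 1 ∧ a * b - e * h ≠ 0) ∨ (e = 0 ∧ a ≠ 0 ∧ b ≠ 0)) :
    ∃ G : ℝ × ℝ → ℝ × ℝ, Differentiable ℝ G ∧
      (∀ x, (a * (G x).1 + e * (G x).2, b * (G x).2 + h * (G x).1 ^ m) = x) ∧
      ∀ x : ℝ × ℝ, G (a * x.1 + e * x.2, b * x.2 + h * x.1 ^ m) = x := by
  rcases hcase with ⟨rfl, hdet⟩ | ⟨rfl, ha, hb⟩
  · refine ⟨fun x => ((b * x.1 - e * x.2) / (a * b - e * h), (a * x.2 - h * x.1) / (a * b - e * h)),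
      by fun_prop, fun x => ?_, fun x => ?_⟩
    · ext
      · simp only
        rw [← mul_div_assoc, ← mul_div_assoc, ← add_div, div_eq_iff hdet]
        ring
      · simp only [pow_one]
        rw [← mul_div_assoc, ← mul_div_assoc, ← add_div, div_eq_iff hdet]
        ring
    · ext
      · simp only [pow_one]
        rw [div_eq_iff hdet]
        ring
      · simp only [pow_one]
        rw [div_eq_iff hdet]
        ring
  · refine ⟨fun x => (x.1 / a, (x.2 - h * (x.1 / a) ^ m) / b), by fun_prop, fun x => ?_,
      fun x => ?_⟩
    · ext
      · simp only; field_simp; ring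
      · simp only; rw [mul_div_cancel₀ _ hb]; ring
    · have e1 : (a * x.1 + 0 * x.2) / a = x.1 := by
        rw [zero_mul, add_zero, mul_div_cancel_left₀ _ ha]
      ext
      · exact e1
      · simp only [e1]; field_simp; ring

/-- The bound for the weights `(1, t)`, `t ≥ 1`, when `∂ψ₁/∂u ≠ 0`. Up to the order `s ≤ t` of the
curve `ψ(u, 0)` relative to the `x₁`-axis the weights `(1, s)` transform without cancellation. If
`s < t`, the multiplicity of the corresponding root of the initial form bounds the power of `v`. -/
theorem exists_weight_le_of_one_le (hφ : ContDiffAt ℝ ∞ φ 0) (hψ : ContDiffAt ℝ ∞ ψ 0)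
    (hψ0 : ψ 0 = 0) (hne : (taylorSupport φ).Nonempty) (hb : InitialFormBound φ d n)
    (hn : ∀ m : ℕ, m < n → (m : ℝ) ≤ d) (hdet : JacobianNeZero ψ)
    (ha : taylorCoeff (fun x => (ψ x).1) 0 (1, 0) ≠ 0) {t : ℝ} (ht : 1 ≤ t) :
    ∃ α ∈ taylorSupport (φ ∘ ψ), weight (1, t) α ≤ (1 + t) * d := by
  have hψ1 : ContDiffAt ℝ ∞ (fun x => (ψ x).1) 0 := contDiffAt_fst.comp 0 hψ
  have hψ2 : ContDiffAt ℝ ∞ (fun x => (ψ x).2) 0 := contDiffAt_snd.comp 0 hψ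
  set ψ₁ : ℝ × ℝ → ℝ := fun x => (ψ x).1 with hψ₁
  set ψ₂ : ℝ × ℝ → ℝ := fun x => (ψ x).2 with hψ₂
  have h00 : (0, 0) ∉ taylorSupport ψ₁ ∧ (0, 0) ∉ taylorSupport ψ₂ := by
    simp [taylorSupport, taylorCoeff, hψ₁, hψ₂, hψ0]
  obtain ⟨s, hs1, hst, hlow, hs⟩ : ∃ s : ℝ, 1 ≤ s ∧ s ≤ t ∧
      (∀ i : ℕ, (i : ℝ) < s → taylorCoeff ψ₂ 0 (i, 0) = 0) ∧
      (s = t ∨ ∃ k : ℕ, s = k ∧ taylorCoeff ψ₂ 0 (k, 0) ≠ 0) := by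
    classical
    by_cases h : ∃ i : ℕ, taylorCoeff ψ₂ 0 (i, 0) ≠ 0 ∧ (i : ℝ) < t
    · have hk := Nat.find_spec h
      have hmin := fun i => Nat.find_min h (m := i)
      set k := Nat.find h
      refine ⟨k, ?_, hk.2.le, fun i hi => ?_, Or.inr ⟨k, rfl, hk.1⟩⟩
      · have : k ≠ 0 := fun h0 => by
          rw [h0] at hk
          exact h00.2 hk.1
        exact_mod_cast Nat.one_le_iff_ne_zero.2 this
      · have h' := hmin i (by exact_mod_cast hi)
        by_contra hc
        exact h' ⟨hc, hi.trans hk.2⟩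
    · push Not at h
      refine ⟨t, ht, le_rfl, fun i hi => ?_, Or.inl rfl⟩
      by_contra hc
      exact absurd (h i hc) (not_le.2 hi)
  have hw1 : 0 < ((1, s) : ℝ × ℝ).1 := one_pos
  have hw2 : 0 < ((1, s) : ℝ × ℝ).2 := one_pos.trans_le hs1
  have hord1 : ∀ α ∈ taylorSupport ψ₁, 1 ≤ weight (1, s) α := by
    rintro ⟨i, j⟩ hα
    rw [weight]
    simp only [one_mul]
    have hi0 : (0 : ℝ) ≤ i := Nat.cast_nonneg i
    rcases Nat.eq_zero_or_pos j with rfl | hj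
    · have : i ≠ 0 := by rintro rfl; exact h00.1 hα
      have : (1 : ℝ) ≤ i := by exact_mod_cast Nat.one_le_iff_ne_zero.2 this
      simpa using this
    · have hj1 : (1 : ℝ) ≤ j := by exact_mod_cast hj
      nlinarith
  have hord2 : ∀ α ∈ taylorSupport ψ₂, s ≤ weight (1, s) α := by
    rintro ⟨i, j⟩ hα
    rw [weight]
    simp only [one_mul]
    have hi0 : (0 : ℝ) ≤ i := Nat.cast_nonneg i
    rcases Nat.eq_zero_or_pos j with rfl | hj
    · by_contra! hc
      exact hα (hlow i (by simpa using hc))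
    · have hj1 : (1 : ℝ) ≤ j := by exact_mod_cast hj
      nlinarith
  obtain ⟨α₀, hα₀, hmin⟩ := exists_min_weight hw1 hw2 hne
  set D := weight (1, s) α₀ with hDdef
  have hDd : D ≤ (1 + s) * d := hb.degree (1, s) D hw1 hw2 hmin
  set a := taylorCoeff ψ₁ 0 (1, 0) with hadef
  set e := if s = 1 then taylorCoeff ψ₁ 0 (0, 1) else 0 with hedef
  set b := taylorCoeff ψ₂ 0 (0, 1) with hbdef
  set h := if (⌊s⌋₊ : ℝ) = s then taylorCoeff ψ₂ 0 (⌊s⌋₊, 0) else 0 with hhdef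
  set g : ℝ × ℝ → ℝ × ℝ := fun x => (a * x.1 + e * x.2, b * x.2 + h * x.1 ^ ⌊s⌋₊) with hg
  obtain ⟨hordf, hform⟩ := initialForm_comp (g := g) hφ hψ hψ0 hw1 hw2 hmin
    (fun x => by
      have := tendsto_initialForm hψ1 hw1 hw2 hord1 (tendsto_const_nhds (x := x))
      rwa [initialForm_fst_component hs1] at this)
    (fun x => by
      have := tendsto_initialForm hψ2 hw1 hw2 hord2 (tendsto_const_nhds (x := x))
      rwa [initialForm_snd_component hs1] at this)
  obtain ⟨G, hGd, hgG, hGg⟩ : ∃ G : ℝ × ℝ → ℝ × ℝ, Differentiable ℝ G ∧ (∀ x, g (G x) = x) ∧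
      ∀ x, G (g x) = x := by
    refine exists_quasihomogeneous_inverse ?_
    rcases hs1.eq_or_lt with hs1' | hs1'
    · left
      refine ⟨by rw [← hs1']; simp, ?_⟩
      rw [hedef, hhdef, ← hs1']
      simp only [Nat.floor_one, Nat.cast_one, if_true]
      exact hdet
    · right
      have h10 : taylorCoeff ψ₂ 0 (1, 0) = 0 := hlow 1 (by simpa using hs1')
      refine ⟨if_neg hs1'.ne', ha, fun hb0 => hdet ?_⟩
      rw [← hψ₂, h10, ← hbdef, hb0]
      ring
  have hnonempty : (initialSupport (φ ∘ ψ) (1, s) D).Nonempty := by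
    obtain ⟨x, hx⟩ := exists_initialForm_ne_zero (f := φ) (D := D) hw1 hw2
      ⟨α₀, (mem_initialSupport hw1 hw2).2 ⟨hα₀, rfl⟩⟩
    by_contra hc
    rw [Finset.not_nonempty_iff_eq_empty] at hc
    have h1 := congrFun hform (G x)
    rw [initialForm_eq_sum hw1 hw2, hc, Finset.sum_empty, Function.comp_apply, hgG] at h1
    exact hx h1.symm
  rcases hs with rfl | ⟨k, hk, hck⟩
  · obtain ⟨α, hα⟩ := hnonempty
    obtain ⟨h1, h2⟩ := (mem_initialSupport hw1 hw2).1 hα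
    exact ⟨α, h1, h2.le.trans hDd⟩
  · have hfloor : ⌊s⌋₊ = k := by rw [hk]; simp
    have hh : h = taylorCoeff ψ₂ 0 (k, 0) := by rw [hhdef, hfloor, if_pos hk.symm]
    obtain ⟨α, hα, hαn⟩ : ∃ α ∈ initialSupport (φ ∘ ψ) (1, s) D, α.2 < n := by
      by_contra! hc
      have hG1 : G (a, h) = (1, 0) := by
        have := hGg (1, 0)
        simpa [hg] using this
      have hv := vanishesTo_initialForm hw1 hw2 hc 1
      rw [← hG1] at hv
      refine hb.order (1, s) D a h hw1 hw2 ha (hh ▸ hck) hmin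
        ⟨α₀, (mem_initialSupport hw1 hw2).2 ⟨hα₀, rfl⟩⟩ ?_
      have := hv.comp hGd.differentiableAt
      rw [hform] at this
      refine this.congr_left fun v => ?_
      simp only [Function.comp_apply, hgG]
    obtain ⟨h1, h2⟩ := (mem_initialSupport hw1 hw2).1 hα
    refine ⟨α, h1, ?_⟩
    have h3 := hn α.2 hαn
    rw [weight] at h2 ⊢
    simp only [one_mul] at h2 ⊢
    have h4 := mul_le_mul_of_nonneg_left h3 (sub_nonneg.2 hst)
    linarith

/-- The bound `exists_weight_le_of_one_le` for arbitrary positive weights. -/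
theorem exists_weight_le (hφ : ContDiffAt ℝ ∞ φ 0) (hψ : ContDiffAt ℝ ∞ ψ 0)
    (hψ0 : ψ 0 = 0) (hne : (taylorSupport φ).Nonempty) (hb : InitialFormBound φ d n)
    (hn : ∀ m : ℕ, m < n → (m : ℝ) ≤ d) (hdet : JacobianNeZero ψ)
    (hw1 : 0 < w.1) (hw2 : 0 < w.2) :
    ∃ α ∈ taylorSupport (φ ∘ ψ), weight w α ≤ (w.1 + w.2) * d := by
  -- interchanging `x₁` and `x₂`, one of the entries in the first column is nonzero
  have step1 : ∀ ψ : ℝ × ℝ → ℝ × ℝ, ContDiffAt ℝ ∞ ψ 0 → ψ 0 = 0 → JacobianNeZero ψ →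
      ∀ t : ℝ, 1 ≤ t → ∃ α ∈ taylorSupport (φ ∘ ψ), weight (1, t) α ≤ (1 + t) * d := by
    intro ψ hψ hψ0 hdet t ht
    by_cases ha : taylorCoeff (fun x => (ψ x).1) 0 (1, 0) = 0
    · have hdet' : JacobianNeZero (Prod.swap ∘ ψ) := by
        unfold JacobianNeZero at hdet ⊢
        simp only [Function.comp_apply, Prod.fst_swap, Prod.snd_swap]
        contrapose! hdet
        linarith
      have ha' : taylorCoeff (fun x => ((Prod.swap ∘ ψ) x).1) 0 (1, 0) ≠ 0 := by
        intro h0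
        simp only [Function.comp_apply, Prod.fst_swap] at h0
        refine hdet ?_
        rw [ha, h0]
        ring
      have hne' : (taylorSupport (φ ∘ Prod.swap)).Nonempty := by
        obtain ⟨α, hα⟩ := hne
        exact ⟨α.swap, (mem_taylorSupport_comp_swap hφ).2 (by simpa using hα)⟩
      have := exists_weight_le_of_one_le (smooth_comp_swap hφ)
        (contDiff_swap.contDiffAt.comp 0 hψ) (by simp [hψ0]) hne' (hb.comp_swap hφ) hn hdet' ha' ht
      rwa [show (φ ∘ Prod.swap) ∘ Prod.swap ∘ ψ = φ ∘ ψ by ext; simp] at this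
    · exact exists_weight_le_of_one_le hφ hψ hψ0 hne hb hn hdet ha ht
  -- interchanging `u` and `v`, the first weight is the smaller one
  have step2 : ∀ ψ : ℝ × ℝ → ℝ × ℝ, ContDiffAt ℝ ∞ ψ 0 → ψ 0 = 0 → JacobianNeZero ψ →
      ∀ w : ℝ × ℝ, 0 < w.1 → w.1 ≤ w.2 →
      ∃ α ∈ taylorSupport (φ ∘ ψ), weight w α ≤ (w.1 + w.2) * d := by
    intro ψ hψ hψ0 hdet w hw hle
    obtain ⟨α, hα, h⟩ := step1 ψ hψ hψ0 hdet (w.2 / w.1) ((one_le_div hw).2 hle)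
    refine ⟨α, hα, ?_⟩
    have := mul_le_mul_of_nonneg_left h hw.le
    rw [weight] at this ⊢
    have e : w.1 * (w.2 / w.1) = w.2 := mul_div_cancel₀ _ hw.ne'
    simp only at this
    calc w.1 * α.1 + w.2 * α.2 = w.1 * (1 * α.1 + w.2 / w.1 * α.2) := by
          rw [mul_add, ← mul_assoc, ← mul_assoc, e]; ring
      _ ≤ _ := this
      _ = _ := by rw [← mul_assoc, mul_add, e]; ring
  rcases le_total w.1 w.2 with hle | hle
  · exact step2 ψ hψ hψ0 hdet w hw1 hle
  · have hs1 : ContDiffAt ℝ ∞ (fun x => (ψ x).1) 0 := contDiffAt_fst.comp 0 hψ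
    have hs2 : ContDiffAt ℝ ∞ (fun x => (ψ x).2) 0 := contDiffAt_snd.comp 0 hψ
    have hdet' : JacobianNeZero (ψ ∘ Prod.swap) := by
      unfold JacobianNeZero at hdet ⊢
      have e1 : (fun x => ((ψ ∘ Prod.swap) x).1) = (fun x => (ψ x).1) ∘ Prod.swap := rfl
      have e2 : (fun x => ((ψ ∘ Prod.swap) x).2) = (fun x => (ψ x).2) ∘ Prod.swap := rfl
      rw [e1, e2, taylorCoeff_comp_swap hs1, taylorCoeff_comp_swap hs2, taylorCoeff_comp_swap hs1,
        taylorCoeff_comp_swap hs2]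
      simp only [Prod.swap_prod_mk]
      contrapose! hdet
      linarith
    have hψ' : ContDiffAt ℝ ∞ (ψ ∘ Prod.swap) 0 := by
      have : ContDiffAt ℝ ∞ ψ (Prod.swap 0) := hψ
      exact this.comp 0 contDiff_swap.contDiffAt
    obtain ⟨α, hα, h⟩ := step2 (ψ ∘ Prod.swap) hψ' (by simp [hψ0]) hdet' w.swap hw2 hle
    have hfs : ContDiffAt ℝ ∞ (φ ∘ ψ) 0 := by
      have : ContDiffAt ℝ ∞ φ (ψ 0) := by rwa [hψ0]
      exact this.comp 0 hψ
    rw [← Function.comp_assoc, mem_taylorSupport_comp_swap hfs] at hα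
    refine ⟨α.swap, hα, ?_⟩
    rw [← weight_swap, Prod.swap_swap]
    rw [Prod.fst_swap, Prod.snd_swap, add_comm] at h
    exact h

/-- Bounds on the initial forms of `φ` bound its Newton distance in all coordinates. -/
theorem newtonDistance_comp_le (hφ : ContDiffAt ℝ ∞ φ 0) (hψ : ContDiffAt ℝ ∞ ψ 0)
    (hψ0 : ψ 0 = 0) (hne : (taylorSupport φ).Nonempty) (hb : InitialFormBound φ d n)
    (hn : ∀ m : ℕ, m < n → (m : ℝ) ≤ d) (hdet : JacobianNeZero ψ) :
    newtonDistance (φ ∘ ψ) ≤ d := by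
  have key := fun (w : ℝ × ℝ) (hw1 : 0 < w.1) (hw2 : 0 < w.2) =>
    exists_weight_le hφ hψ hψ0 hne hb hn hdet hw1 hw2
  have hne' : (taylorSupport (φ ∘ ψ)).Nonempty := by
    obtain ⟨α, hα, -⟩ := key (1, 1) one_pos one_pos
    exact ⟨α, hα⟩
  obtain ⟨κ, hκ1, hκ2, hκ, hsupp⟩ := exists_supporting_weight hne'
  refine le_of_forall_pos_le_add fun ε hε => ?_
  -- the supporting weights may vanish, so they are made positive
  set η := ε / (2 * |d| + 1)
  have hη : 0 < η := by positivity
  obtain ⟨α, hα, h⟩ := key (κ.1 + η, κ.2 + η) (by simp only; linarith) (by simp only; linarith)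
  have h1 := hsupp α hα
  have h2 : weight κ α ≤ weight (κ.1 + η, κ.2 + η) α := by
    simp only [weight]
    have : 0 ≤ η * α.1 := by positivity
    have : 0 ≤ η * α.2 := by positivity
    linarith
  have h3 : (κ.1 + η + (κ.2 + η)) * d = d + η * (2 * d) := by
    rw [show κ.1 + η + (κ.2 + η) = (κ.1 + κ.2) + 2 * η by ring, hκ]; ring
  have h4 : η * (2 * d) ≤ ε := by
    have e : η * (2 * |d| + 1) = ε := div_mul_cancel₀ _ (by positivity)
    have := le_abs_self d
    nlinarith
  simp only [h3] at h
  linarith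

end

section

/-! ### The principal face -/

variable {φ : ℝ × ℝ → ℝ} {w : ℝ × ℝ} {D d : ℝ} {n : ℕ}

lemma facePart_inter_weightLine (hw1 : 0 < w.1) (hw2 : 0 < w.2) :
    facePart φ (newtonPolyhedron φ ∩ weightLine w D) = initialForm φ w D := by
  classical
  ext x
  rw [initialForm_eq_sum hw1 hw2, facePart_eq_sum (S := initialSupport φ w D)]
  · refine Finset.sum_congr rfl fun α hα => if_pos ?_
    obtain ⟨h1, h2⟩ := (mem_initialSupport hw1 hw2).1 hα
    exact ⟨toPlane_mem_newtonPolyhedron h1, h2⟩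
  · exact fun α h1 h2 => (mem_initialSupport hw1 hw2).2 ⟨h2, h1.2⟩

lemma isBounded_inter_weightLine (hw1 : 0 < w.1) (hw2 : 0 < w.2) :
    Bornology.IsBounded (newtonPolyhedron φ ∩ weightLine w D) := by
  refine (Metric.isBounded_Icc (0 : ℝ × ℝ) (D / w.1, D / w.2)).subset ?_
  rintro t ⟨ht, hl⟩
  have h0 := newtonPolyhedron_nonneg ht
  have h1 : 0 ≤ w.1 * t.1 := mul_nonneg hw1.le h0.1
  have h2 : 0 ≤ w.2 * t.2 := mul_nonneg hw2.le h0.2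
  have hl' : w.1 * t.1 + w.2 * t.2 = D := hl
  refine ⟨h0, ?_, ?_⟩
  · rw [le_div_iff₀' hw1]; linarith
  · rw [le_div_iff₀' hw2]; linarith

/-- If a supporting line carries points of the Taylor support on both sides of the diagonal, it
meets the diagonal in `(d, d)`, and it cuts out the only face through this point. -/
theorem face_eq_of_both_sides (hw1 : 0 < w.1) (hw2 : 0 < w.2)
    (hD : ∀ α ∈ taylorSupport φ, D ≤ weight w α) {α β : ℕ × ℕ}
    (hα : α ∈ initialSupport φ w D) (hβ : β ∈ initialSupport φ w D)
    (hα12 : α.2 < α.1) (hβ12 : β.1 < β.2) {F : Set (ℝ × ℝ)} (hF : IsFace (newtonPolyhedron φ) F)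
    (hdF : ((newtonDistance φ, newtonDistance φ) : ℝ × ℝ) ∈ F) :
    F = newtonPolyhedron φ ∩ weightLine w D ∧ dim F ≠ 0 := by
  obtain ⟨hαs, hαw⟩ := (mem_initialSupport hw1 hw2).1 hα
  obtain ⟨hβs, hβw⟩ := (mem_initialSupport hw1 hw2).1 hβ
  have hαN := toPlane_mem_newtonPolyhedron hαs
  have hβN := toPlane_mem_newtonPolyhedron hβs
  have hN : ∀ t ∈ newtonPolyhedron φ, D ≤ w.1 * t.1 + w.2 * t.2 := fun t ht =>
    newtonPolyhedron_subset_halfPlane hw1.le hw2.le hD ht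
  rw [weight] at hαw hβw
  have c1 : (α.2 : ℝ) < α.1 := by exact_mod_cast hα12
  have c2 : (β.1 : ℝ) < β.2 := by exact_mod_cast hβ12
  -- the point of the segment from `α` to `β` on the diagonal
  set x : ℝ := α.1 - α.2 with hx
  set y : ℝ := β.2 - β.1 with hy
  have hxpos : 0 < x := by linarith
  have hypos : 0 < y := by linarith
  have hxy : x + y ≠ 0 := by positivity
  have hsum : y / (x + y) + x / (x + y) = 1 := by rw [← add_div, add_comm y x, div_self hxy]
  have hcpos1 : 0 < y / (x + y) := by positivity
  have hcpos2 : 0 < x / (x + y) := by positivity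
  set s : ℝ := y / (x + y) * α.1 + x / (x + y) * β.1 with hs
  have hs' : s = y / (x + y) * α.2 + x / (x + y) * β.2 := by
    have e1 : (α.1 : ℝ) = α.2 + x := by rw [hx]; ring
    have e2 : (β.2 : ℝ) = β.1 + y := by rw [hy]; ring
    rw [hs, e1, e2]
    ring
  have hseg : (y / (x + y)) • toPlane α + (x / (x + y)) • toPlane β = (s, s) := by
    ext
    · simp only [toPlane, Prod.fst_add, Prod.smul_fst, smul_eq_mul]; rw [hs]
    · simp only [toPlane, Prod.snd_add, Prod.smul_snd, smul_eq_mul]; rw [hs']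
  have hsN : ((s, s) : ℝ × ℝ) ∈ newtonPolyhedron φ := by
    rw [← hseg]
    exact (convex_convexHull ℝ _) hαN hβN hcpos1.le hcpos2.le hsum
  have hsD : (w.1 + w.2) * s = D := by
    calc (w.1 + w.2) * s = w.1 * s + w.2 * s := by ring
      _ = w.1 * (y / (x + y) * α.1 + x / (x + y) * β.1)
          + w.2 * (y / (x + y) * α.2 + x / (x + y) * β.2) := by rw [← hs, ← hs']
      _ = y / (x + y) * (w.1 * α.1 + w.2 * α.2) + x / (x + y) * (w.1 * β.1 + w.2 * β.2) := by ring
      _ = (y / (x + y) + x / (x + y)) * D := by rw [hαw, hβw]; ring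
      _ = D := by rw [hsum, one_mul]
  have hds : newtonDistance φ = s := by
    refine le_antisymm (newtonDistance_le hsN) ?_
    have := le_mul_newtonDistance ⟨α, hαs⟩ hw1.le hw2.le (by linarith) hD
    rw [← hsD] at this
    exact le_of_mul_le_mul_left this (by linarith)
  have hne2 : (α.2 : ℝ) ≠ β.2 := by
    intro h
    rw [h] at hαw
    have : (α.1 : ℝ) = β.1 := mul_left_cancel₀ hw1.ne' (by linarith)
    linarith
  obtain ⟨hexp, hdim⟩ : IsExposed ℝ (newtonPolyhedron φ) F ∧ dim F ≤ 1 := by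
    rcases hF with h | h
    · exact ⟨h.2.1, h.2.2.le⟩
    · exact ⟨h.2.1, h.2.2.le.trans zero_le_one⟩
  obtain ⟨l, hl⟩ := hexp ⟨_, hdF⟩
  rw [hds] at hdF
  have hmax : ∀ t ∈ newtonPolyhedron φ, l t ≤ l (s, s) := by
    rw [hl] at hdF; exact hdF.2
  have hlseg : y / (x + y) * l (toPlane α) + x / (x + y) * l (toPlane β) = l (s, s) := by
    rw [← hseg, map_add, map_smul, map_smul, smul_eq_mul, smul_eq_mul]
  have hlα : l (toPlane α) = l (s, s) := by
    refine le_antisymm (hmax _ hαN) ?_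
    by_contra! hc
    have e1 := mul_lt_mul_of_pos_left hc hcpos1
    have e2 := mul_le_mul_of_nonneg_left (hmax _ hβN) hcpos2.le
    have e3 : l (s, s) = y / (x + y) * l (s, s) + x / (x + y) * l (s, s) := by
      rw [← add_mul, hsum, one_mul]
    linarith
  have hlβ : l (toPlane β) = l (s, s) := by
    rw [hlα] at hlseg
    have e3 : l (s, s) = y / (x + y) * l (s, s) + x / (x + y) * l (s, s) := by
      rw [← add_mul, hsum, one_mul]
    exact mul_left_cancel₀ hcpos2.ne' (by linarith)
  have hmemF : ∀ t ∈ newtonPolyhedron φ, l t = l (s, s) → t ∈ F := by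
    intro t ht h
    rw [hl]
    exact ⟨ht, fun z hz => by rw [h]; exact hmax z hz⟩
  have hαF := hmemF _ hαN hlα
  have hβF := hmemF _ hβN hlβ
  have hcol : Collinear ℝ F := collinear_iff_finrank_le_one.2 hdim
  have hα1N : toPlane α + (1, 0) ∈ newtonPolyhedron φ :=
    newtonPolyhedron_upward hαN ⟨by simp, by simp⟩
  have hp_le : l (1, 0) ≤ 0 := by
    have := hmax _ hα1N
    rw [map_add, hlα] at this
    linarith
  have hp_ne : l (1, 0) ≠ 0 := by
    intro h0
    have hα1F : toPlane α + (1, 0) ∈ F := hmemF _ hα1N (by rw [map_add, hlα, h0, add_zero])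
    obtain ⟨v, hv⟩ := (collinear_iff_of_mem hαF).1 hcol
    obtain ⟨r, hr⟩ := hv _ hα1F
    obtain ⟨r', hr'⟩ := hv _ hβF
    have a1 := congrArg Prod.fst hr
    have a2 := congrArg Prod.snd hr
    have a3 := congrArg Prod.snd hr'
    simp only [toPlane, vadd_eq_add, Prod.fst_add, Prod.snd_add, Prod.smul_fst, Prod.smul_snd,
      smul_eq_mul] at a1 a2 a3
    have hr0 : r ≠ 0 := by
      rintro rfl
      linarith
    have hv2 : v.2 = 0 := by
      have : r * v.2 = 0 := by linarith
      exact (mul_eq_zero.1 this).resolve_left hr0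
    rw [hv2, mul_zero, zero_add] at a3
    exact hne2 a3.symm
  have hp : l (1, 0) < 0 := lt_of_le_of_ne hp_le hp_ne
  have hpq : l (1, 0) * w.2 = l (0, 1) * w.1 := by
    have e := hlα.trans hlβ.symm
    rw [apply_eq_coords, apply_eq_coords l (toPlane β)] at e
    simp only [toPlane] at e
    have hne : (α.2 : ℝ) - β.2 ≠ 0 := sub_ne_zero.2 hne2
    refine mul_right_cancel₀ hne ?_
    have e1 : w.2 * ((α.2 : ℝ) - β.2) = w.1 * (β.1 - α.1) := by linarith
    calc l (1, 0) * w.2 * (α.2 - β.2) = l (1, 0) * (w.2 * (α.2 - β.2)) := by ring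
      _ = w.1 * (l (1, 0) * (β.1 - α.1)) := by rw [e1]; ring
      _ = w.1 * (l (0, 1) * (α.2 - β.2)) := by
        congr 1
        linarith
      _ = _ := by ring
  have hlw : ∀ t : ℝ × ℝ, l t * w.1 = l (1, 0) * (w.1 * t.1 + w.2 * t.2) := by
    intro t
    rw [apply_eq_coords l t, add_mul, mul_assoc t.2, ← hpq]
    ring
  refine ⟨?_, fun h0 => ?_⟩
  · ext t
    constructor
    · intro ht
      rw [hl] at ht
      refine ⟨ht.1, le_antisymm ?_ (hN t ht.1)⟩
      have h1 := mul_le_mul_of_nonneg_right (ht.2 _ hαN) hw1.le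
      rw [hlw, hlw] at h1
      simp only [toPlane, hαw] at h1
      exact (mul_le_mul_left_of_neg hp).1 h1
    · rintro ⟨htN, htl⟩
      refine hmemF t htN ?_
      rw [← hlα]
      refine mul_right_cancel₀ hw1.ne' ?_
      rw [hlw, hlw]
      have htl' : w.1 * t.1 + w.2 * t.2 = D := htl
      simp only [toPlane, hαw, htl']
  · rw [dim, Submodule.finrank_eq_zero, vectorSpan_eq_bot_iff_subsingleton] at h0
    exact hne2 (congrArg Prod.snd (h0 hαF hβF))

lemma exists_dilate_mem_circle (hw1 : 0 < w.1) (hw2 : 0 < w.2) {a : ℝ} (ha : a ≠ 0) (b : ℝ) :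
    ∃ r > 0, (dilate w r (a, b)).1 ^ 2 + (dilate w r (a, b)).2 ^ 2 = 1 := by
  set h : ℝ → ℝ := fun r => (r ^ w.1 * a) ^ 2 + (r ^ w.2 * b) ^ 2 with hh
  have hcont : Continuous h := by
    have c1 : Continuous fun r : ℝ => r ^ w.1 := Real.continuous_rpow_const hw1.le
    have c2 : Continuous fun r : ℝ => r ^ w.2 := Real.continuous_rpow_const hw2.le
    fun_prop
  have h0 : h 0 = 0 := by simp [hh, Real.zero_rpow hw1.ne', Real.zero_rpow hw2.ne']
  set R : ℝ := (|a|⁻¹) ^ (w.1)⁻¹ with hR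
  have hR0 : 0 ≤ R := by positivity
  have hRa : R ^ w.1 = |a|⁻¹ := by
    rw [hR, ← Real.rpow_mul (by positivity), inv_mul_cancel₀ hw1.ne', Real.rpow_one]
  have h1 : 1 ≤ h R := by
    have : (R ^ w.1 * a) ^ 2 = 1 := by
      rw [hRa, mul_pow, inv_pow, sq_abs, inv_mul_cancel₀ (pow_ne_zero _ ha)]
    rw [hh]
    simp only [this]
    nlinarith [sq_nonneg (R ^ w.2 * b)]
  obtain ⟨r, hr, hr1⟩ := intermediate_value_Icc hR0 hcont.continuousOn ⟨h0.le.trans zero_le_one, h1⟩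
  refine ⟨r, lt_of_le_of_ne hr.1 ?_, hr1⟩
  rintro rfl
  rw [h0] at hr1
  exact zero_ne_one hr1

/-- The order of vanishing of an initial form is constant along the orbits of the dilations. -/
lemma VanishesTo.dilate (hw1 : 0 < w.1) (hw2 : 0 < w.2) {x : ℝ × ℝ}
    (h : VanishesTo (initialForm φ w D) x n) {r : ℝ} (hr : 0 < r) :
    VanishesTo (initialForm φ w D) (dilate w r x) n := by
  have hinv : NewtonHeight.dilate w r⁻¹ (NewtonHeight.dilate w r x) = x := by
    have e1 := (Real.rpow_pos_of_pos hr w.1).ne'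
    have e2 := (Real.rpow_pos_of_pos hr w.2).ne'
    ext
    · simp only [NewtonHeight.dilate, Real.inv_rpow hr.le]; field_simp
    · simp only [NewtonHeight.dilate, Real.inv_rpow hr.le]; field_simp
  have hd : Differentiable ℝ (NewtonHeight.dilate w r⁻¹) := by
    unfold NewtonHeight.dilate
    fun_prop
  rw [← hinv] at h
  have h' := (h.comp (hd _)).const_mul (r ^ D)
  refine h'.congr_left fun v => ?_
  simp only [Function.comp_apply]
  rw [initialForm_dilate hw1 hw2 (inv_pos.2 hr), Real.inv_rpow hr.le,
    ← mul_assoc, mul_inv_cancel₀ (Real.rpow_pos_of_pos hr D).ne', one_mul]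

lemma coe_natCast_ennreal (n : ℕ) : ((n : ENNReal) : EReal) = ((n : ℝ) : EReal) := by
  rw [← ENNReal.coe_natCast, EReal.coe_nnreal_eq_coe_real, NNReal.coe_natCast]

lemma natCast_le_of_le_coe {m : ℕ∞} (h : ((m : ENNReal) : EReal) ≤ ((d : ℝ) : EReal))
    (hn : (n : ℕ∞) ≤ m) : (n : ℝ) ≤ d := by
  have h1 : ((n : ℕ∞) : ENNReal) ≤ (m : ENNReal) := ENat.toENNReal_le.2 hn
  have h2 : ((((n : ℕ∞) : ENNReal)) : EReal) ≤ ((d : ℝ) : EReal) :=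
    (EReal.coe_ennreal_le_coe_ennreal_iff.2 h1).trans h
  rw [ENat.toENNReal_coe, coe_natCast_ennreal, EReal.coe_le_coe_iff] at h2
  exact h2

lemma coe_le_of_le_floor {m : ℕ∞} (hd : 0 ≤ d) (h : m ≤ (⌊d⌋₊ : ℕ∞)) :
    ((m : ENNReal) : EReal) ≤ ((d : ℝ) : EReal) := by
  have h1 : (m : ENNReal) ≤ ((⌊d⌋₊ : ℕ∞) : ENNReal) := ENat.toENNReal_le.2 h
  refine (EReal.coe_ennreal_le_coe_ennreal_iff.2 h1).trans ?_
  rw [ENat.toENNReal_coe, coe_natCast_ennreal, EReal.coe_le_coe_iff]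
  exact Nat.floor_le hd

/-- Each of the three conditions bounds the initial forms: an initial form that vanishes to high
order off the axes belongs to the principal face, and this face is a compact edge. -/
theorem initialFormBound_of_principalFace (hne : (taylorSupport φ).Nonempty)
    (h : (∃ F, IsPrincipalFace φ F ∧ IsEdge (newtonPolyhedron φ) F ∧ IsCompact F ∧
          ((circleOrder (facePart φ F) : ENNReal) : EReal) ≤ ((newtonDistance φ : ℝ) : EReal)) ∨
        (∃ F, IsPrincipalFace φ F ∧ IsVertex (newtonPolyhedron φ) F) ∨
        (∃ F, IsPrincipalFace φ F ∧ IsEdge (newtonPolyhedron φ) F ∧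
          ¬ Bornology.IsBounded F)) :
    InitialFormBound φ (newtonDistance φ) (⌊newtonDistance φ⌋₊ + 1) := by
  have hdeg : ∀ (w : ℝ × ℝ) (D : ℝ), 0 < w.1 → 0 < w.2 →
      (∀ α ∈ taylorSupport φ, D ≤ weight w α) → D ≤ (w.1 + w.2) * newtonDistance φ :=
    fun w D hw1 hw2 hD => le_mul_newtonDistance hne hw1.le hw2.le (by linarith) hD
  refine ⟨hdeg, fun w D a b hw1 hw2 ha hb hD hS hv => ?_⟩
  have hlt : newtonDistance φ < ((⌊newtonDistance φ⌋₊ + 1 : ℕ) : ℝ) := by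
    push_cast
    exact Nat.lt_floor_add_one _
  have hcard := lt_card_initialSupport hw1 hw2 ha hb hS hv
  obtain ⟨⟨α, hα, hα12⟩, ⟨β, hβ, hβ12⟩⟩ :=
    exists_both_sides hw1 hw2 (hdeg w D hw1 hw2 hD) hlt hcard
  have key : ∀ F, IsPrincipalFace φ F → F = newtonPolyhedron φ ∩ weightLine w D ∧ dim F ≠ 0 :=
    fun F hF => face_eq_of_both_sides hw1 hw2 hD hα hβ hα12 hβ12 hF.1 hF.2.1
  rcases h with ⟨F, hF, -, -, hm⟩ | ⟨F, hF, hV⟩ | ⟨F, hF, -, hunb⟩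
  · rw [(key F hF).1, facePart_inter_weightLine hw1 hw2] at hm
    obtain ⟨r, hr, hcirc⟩ := exists_dilate_mem_circle hw1 hw2 ha b
    have h1 := (le_vanishingOrder_iff
      (contDiff_initialForm hw1 hw2).contDiffAt).2 (hv.dilate hw1 hw2 hr)
    have h2 : vanishingOrder (initialForm φ w D) (dilate w r (a, b)) ≤
        circleOrder (initialForm φ w D) := le_iSup₂_of_le _ hcirc le_rfl
    exact absurd (natCast_le_of_le_coe hm (h1.trans h2)) (not_le.2 hlt)
  · exact (key F hF).2 hV.2.2
  · rw [(key F hF).1] at hunb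
    exact hunb (isBounded_inter_weightLine hw1 hw2)

/-! ### Coordinates with a larger Newton distance -/

lemma le_snd_of_vanishesTo (hw1 : 0 < w.1) (hw2 : 0 < w.2) {a : ℝ} (ha : a ≠ 0)
    (h : VanishesTo (initialForm φ w D) (a, 0) n) {α : ℕ × ℕ} (hα : α ∈ initialSupport φ w D) :
    n ≤ α.2 := by
  have hdvd := pow_dvd_sectionPoly hw1 hw2 h
  rw [Polynomial.C_0, sub_zero, Polynomial.X_pow_dvd_iff] at hdvd
  by_contra! hc
  have := hdvd α.2 hc
  rw [coeff_sectionPoly hw1 hw2 a hα] at this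
  exact mul_ne_zero ((mem_initialSupport hw1 hw2).1 hα).1 (pow_ne_zero _ ha) this

lemma vanishesTo_comp_swap (hφ : ContDiffAt ℝ ∞ φ 0) (hw1 : 0 < w.1) (hw2 : 0 < w.2) {x : ℝ × ℝ}
    (h : VanishesTo (initialForm φ w D) x n) :
    VanishesTo (initialForm (φ ∘ Prod.swap) w.swap D) x.swap n := by
  rw [← Prod.swap_swap x] at h
  have := h.comp (contDiff_swap.differentiable (by simp)).differentiableAt
  refine this.congr_left fun v => ?_
  rw [Function.comp_apply, initialForm_comp_swap hφ (w := w.swap) hw2 hw1, Prod.swap_swap]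

lemma swap_mem_initialSupport (hφ : ContDiffAt ℝ ∞ φ 0) (hw1 : 0 < w.1) (hw2 : 0 < w.2)
    {α : ℕ × ℕ} (hα : α ∈ initialSupport φ w D) :
    α.swap ∈ initialSupport (φ ∘ Prod.swap) w.swap D := by
  rw [mem_initialSupport hw1 hw2] at hα
  rw [mem_initialSupport (w := w.swap) hw2 hw1, mem_taylorSupport_comp_swap hφ, weight_swap,
    Prod.swap_swap]
  exact hα

/-- The shear `(u, v) ↦ (u, v + c u ^ k)`. -/
def shear (c : ℝ) (k : ℕ) : (ℝ × ℝ) ≃ₜ (ℝ × ℝ) where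
  toFun x := (x.1, x.2 + c * x.1 ^ k)
  invFun x := (x.1, x.2 - c * x.1 ^ k)
  left_inv x := by simp
  right_inv x := by simp
  continuous_toFun := by fun_prop
  continuous_invFun := by fun_prop

lemma contDiff_shear (c : ℝ) (k : ℕ) : ContDiff ℝ ∞ (shear c k) := by
  change ContDiff ℝ ∞ fun x : ℝ × ℝ => (x.1, x.2 + c * x.1 ^ k)
  fun_prop

lemma contDiff_shear_symm (c : ℝ) (k : ℕ) : ContDiff ℝ ∞ (shear c k).symm := by
  change ContDiff ℝ ∞ fun x : ℝ × ℝ => (x.1, x.2 - c * x.1 ^ k)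
  fun_prop

/-- If `w₂ = k w₁` and the initial form of degree `(w₁ + w₂) d` vanishes at `(a, b)` to an order
greater than `d`, then straightening the curve `x₂ = b (x₁ / a) ^ k` increases the Newton distance
beyond `d`. -/
theorem lt_newtonDistance_comp_shear (hφ : ContDiffAt ℝ ∞ φ 0) (hw1 : 0 < w.1) (hw2 : 0 < w.2)
    {k : ℕ} (hk : 1 ≤ k) (hwk : w.2 = k * w.1) (hD : ∀ α ∈ taylorSupport φ, D ≤ weight w α)
    (hDd : (w.1 + w.2) * d = D) (hdn : d < n) (hne : (initialSupport φ w D).Nonempty) {a b : ℝ}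
    (ha : a ≠ 0) (hv : VanishesTo (initialForm φ w D) (a, b) n) :
    d < newtonDistance (φ ∘ shear (b / a ^ k) k) := by
  set ψ := shear (b / a ^ k) k with hψ
  have hψ0 : ψ 0 = 0 := by
    have : k ≠ 0 := by omega
    simp [hψ, shear, this]
  have hdil : ∀ x, ∀ r > 0, ψ (dilate w r x) = dilate w r (ψ x) := by
    intro x r hr
    have e : (r ^ w.1) ^ k = r ^ w.2 := by
      rw [hwk, mul_comm, Real.rpow_mul hr.le, Real.rpow_natCast]
    ext
    · rfl
    · change r ^ w.2 * x.2 + b / a ^ k * (r ^ w.1 * x.1) ^ k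
        = r ^ w.2 * (x.2 + b / a ^ k * x.1 ^ k)
      rw [mul_pow, e]
      ring
  obtain ⟨hord, hform⟩ := initialForm_comp (g := ψ) hφ (contDiff_shear _ _).contDiffAt hψ0 hw1 hw2
    hD
    (fun x => by
      refine tendsto_const_nhds.congr' ?_
      filter_upwards [self_mem_nhdsWithin] with r (hr : 0 < r)
      rw [← hψ, hdil x r hr, dilate, mul_div_cancel_left₀ _ (Real.rpow_pos_of_pos hr _).ne'])
    (fun x => by
      refine tendsto_const_nhds.congr' ?_
      filter_upwards [self_mem_nhdsWithin] with r (hr : 0 < r)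
      rw [← hψ, hdil x r hr, dilate, mul_div_cancel_left₀ _ (Real.rpow_pos_of_pos hr _).ne'])
  rw [← hψ] at hord hform
  have hnonempty : (initialSupport (φ ∘ ψ) w D).Nonempty := by
    obtain ⟨x, hx⟩ := exists_initialForm_ne_zero hw1 hw2 hne
    by_contra hc
    rw [Finset.not_nonempty_iff_eq_empty] at hc
    have h1 := congrFun hform (ψ.symm x)
    rw [initialForm_eq_sum hw1 hw2, hc, Finset.sum_empty, Function.comp_apply,
      ψ.apply_symm_apply] at h1
    exact hx h1.symm
  have hψa : ψ (a, 0) = (a, b) := by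
    have : a ^ k ≠ 0 := pow_ne_zero _ ha
    simp [hψ, shear, this]
  have hvF : VanishesTo (initialForm (φ ∘ ψ) w D) (a, 0) n := by
    rw [hform]
    rw [← hψa] at hv
    exact hv.comp ((contDiff_shear _ _).differentiable (by simp)).differentiableAt
  obtain ⟨α, hα⟩ := hnonempty
  refine lt_newtonDistance_of_tilt (e := (0, 1)) (c := n)
    ⟨α, ((mem_initialSupport hw1 hw2).1 hα).1⟩ hw1 hw2 hord le_rfl zero_le_one hDd
    (by simpa using hdn) fun β hβ => ?_
  simpa [weight] using le_snd_of_vanishesTo hw1 hw2 ha hvF hβ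

/-- A diffeomorphism of the plane that increases the Newton distance, in the situation of
`exists_nat_weight_ratio`. -/
theorem exists_diffeomorphism (hφ : ContDiffAt ℝ ∞ φ 0) (hw1 : 0 < w.1) (hw2 : 0 < w.2)
    {k : ℕ} (hk : 1 ≤ k) (hwk : w.2 = k * w.1 ∨ w.1 = k * w.2)
    (hD : ∀ α ∈ taylorSupport φ, D ≤ weight w α)
    (hDd : (w.1 + w.2) * d = D) (hdn : d < n) (hne : (initialSupport φ w D).Nonempty) {a b : ℝ}
    (ha : a ≠ 0) (hb : b ≠ 0) (hv : VanishesTo (initialForm φ w D) (a, b) n) :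
    ∃ ψ : (ℝ × ℝ) ≃ₜ (ℝ × ℝ), ContDiff ℝ ∞ ψ ∧ ContDiff ℝ ∞ ψ.symm ∧ ψ 0 = 0 ∧
      d < newtonDistance (φ ∘ ψ) := by
  have hk0 : k ≠ 0 := by omega
  rcases hwk with hwk | hwk
  · exact ⟨shear (b / a ^ k) k, contDiff_shear _ _, contDiff_shear_symm _ _, by simp [shear, hk0],
      lt_newtonDistance_comp_shear hφ hw1 hw2 hk hwk hD hDd hdn hne ha hv⟩
  · refine ⟨(shear (a / b ^ k) k).trans (Homeomorph.prodComm ℝ ℝ),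
      contDiff_swap.comp (contDiff_shear _ _), (contDiff_shear_symm _ _).comp contDiff_swap,
      by simp [shear, hk0], ?_⟩
    have hD' : ∀ α ∈ taylorSupport (φ ∘ Prod.swap), D ≤ weight w.swap α := by
      intro α hα
      have := hD _ ((mem_taylorSupport_comp_swap hφ).1 hα)
      rwa [← weight_swap, Prod.swap_swap] at this
    obtain ⟨α, hα⟩ := hne
    exact lt_newtonDistance_comp_shear (w := w.swap) (smooth_comp_swap hφ) hw2 hw1 hk hwk hD'
      (by rw [← hDd, Prod.fst_swap, Prod.snd_swap, add_comm]) hdn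
      ⟨_, swap_mem_initialSupport hφ hw1 hw2 hα⟩ hb (vanishesTo_comp_swap hφ hw1 hw2 hv)

/-! ### Local coordinates and adaptedness -/

lemma jacobianNeZero_of_isLocalCoordinates {y : OpenPartialHomeomorph (ℝ × ℝ) (ℝ × ℝ)}
    (hy : IsLocalCoordinates y) :
    ContDiffAt ℝ ∞ y.symm 0 ∧ y.symm 0 = 0 ∧ JacobianNeZero y.symm := by
  obtain ⟨h0, hy0, hs, hs'⟩ := hy
  have ht : (0 : ℝ × ℝ) ∈ y.target := by rw [← hy0]; exact y.map_source h0
  have hψ : ContDiffAt ℝ ∞ y.symm 0 := hs'.contDiffAt (y.open_target.mem_nhds ht)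
  have hψ0 : y.symm 0 = 0 := by
    have := y.left_inv h0
    rwa [hy0] at this
  have hyd : DifferentiableAt ℝ y 0 :=
    (hs.contDiffAt (y.open_source.mem_nhds h0)).differentiableAt (by simp)
  have hψd : DifferentiableAt ℝ y.symm 0 := hψ.differentiableAt (by simp)
  refine ⟨hψ, hψ0, fun hdet => ?_⟩
  have hinj : ∀ v, fderiv ℝ y.symm 0 v = 0 → v = 0 := by
    intro v hv
    have hid : y ∘ y.symm =ᶠ[𝓝 0] id := by
      filter_upwards [y.open_target.mem_nhds ht] with z hz
      exact y.right_inv hz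
    have h1 := hid.fderiv_eq (𝕜 := ℝ)
    rw [fderiv_id, fderiv_comp _ (by rwa [hψ0]) hψd] at h1
    have h2 := congrArg (fun L : ℝ × ℝ →L[ℝ] ℝ × ℝ => L v) h1
    simpa [hv] using h2.symm
  have h10 : ∀ f : ℝ × ℝ → ℝ, taylorCoeff f 0 (1, 0) = fderiv ℝ f 0 (1, 0) := fun f => by
    simp [taylorCoeff, partial1]
  have h01 : ∀ f : ℝ × ℝ → ℝ, taylorCoeff f 0 (0, 1) = fderiv ℝ f 0 (0, 1) := fun f => by
    simp [taylorCoeff, partial2]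
  have e1 : fderiv ℝ (fun x => (y.symm x).1) 0 = (ContinuousLinearMap.fst ℝ ℝ ℝ).comp
      (fderiv ℝ y.symm 0) := (hψd.hasFDerivAt.fst).fderiv
  have e2 : fderiv ℝ (fun x => (y.symm x).2) 0 = (ContinuousLinearMap.snd ℝ ℝ ℝ).comp
      (fderiv ℝ y.symm 0) := (hψd.hasFDerivAt.snd).fderiv
  rw [h10, h10, h01, h01, e1, e2] at hdet
  simp only [ContinuousLinearMap.comp_apply, ContinuousLinearMap.coe_fst',
    ContinuousLinearMap.coe_snd'] at hdet
  set L := fderiv ℝ y.symm 0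
  have hL : ∀ p q : ℝ, L (p, q) = p • L (1, 0) + q • L (0, 1) := by
    intro p q
    rw [← map_smul, ← map_smul, ← map_add]
    congr 1
    ext <;> simp
  -- the rows of the adjugate matrix are in the kernel
  have k1 := hinj ((L (0, 1)).1, -(L (1, 0)).1) (by
    rw [hL]
    ext
    · simp; ring
    · simp; linarith)
  have k2 := hinj ((L (0, 1)).2, -(L (1, 0)).2) (by
    rw [hL]
    ext
    · simp; linarith
    · simp; ring)
  have k3 : L (1, 0) = 0 := by
    ext
    · simpa using congrArg Prod.snd k1
    · simpa using congrArg Prod.snd k2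
  have := congrArg Prod.fst (hinj _ k3)
  simp at this

lemma newtonDistance_le_height (φ : ℝ × ℝ → ℝ) {ψ : (ℝ × ℝ) ≃ₜ (ℝ × ℝ)} (h1 : ContDiff ℝ ∞ ψ)
    (h2 : ContDiff ℝ ∞ ψ.symm) (h0 : ψ 0 = 0) :
    ((newtonDistance (φ ∘ ψ) : ℝ) : EReal) ≤ height φ := by
  refine le_iSup₂_of_le ψ.symm.toOpenPartialHomeomorph ⟨by simp, ?_, ?_, ?_⟩ le_rfl
  · change ψ.symm 0 = 0
    rw [← h0, ψ.symm_apply_apply, h0]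
  · exact h2.contDiffOn
  · exact h1.contDiffOn

lemma dim_inter_weightLine_le {κ : ℝ × ℝ} (hκ : 0 < κ.1 ^ 2 + κ.2 ^ 2) (N : Set (ℝ × ℝ)) {D : ℝ}
    {p : ℝ × ℝ} (hp : p ∈ N ∩ weightLine κ D) : dim (N ∩ weightLine κ D) ≤ 1 := by
  refine collinear_iff_finrank_le_one.1 ((collinear_iff_of_mem hp).2 ⟨(κ.2, -κ.1), ?_⟩)
  rintro t ⟨-, ht⟩
  have h1 : κ.1 * t.1 + κ.2 * t.2 = D := ht
  have h2 : κ.1 * p.1 + κ.2 * p.2 = D := hp.2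
  refine ⟨(κ.2 * (t.1 - p.1) - κ.1 * (t.2 - p.2)) / (κ.1 ^ 2 + κ.2 ^ 2), ?_⟩
  ext
  · simp only [vadd_eq_add, Prod.fst_add, Prod.smul_fst, smul_eq_mul]
    rw [div_mul_eq_mul_div, ← sub_eq_iff_eq_add, eq_div_iff hκ.ne']
    linear_combination κ.1 * (h1 - h2)
  · simp only [vadd_eq_add, Prod.snd_add, Prod.smul_snd, smul_eq_mul]
    rw [div_mul_eq_mul_div, ← sub_eq_iff_eq_add, eq_div_iff hκ.ne']
    linear_combination κ.2 * (h1 - h2)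

lemma isExposed_inter_weightLine {N : Set (ℝ × ℝ)} {κ : ℝ × ℝ} {D : ℝ}
    (hN : ∀ t ∈ N, D ≤ κ.1 * t.1 + κ.2 * t.2) : IsExposed ℝ N (N ∩ weightLine κ D) := by
  rintro ⟨p, hpN, hp⟩
  have hp' : κ.1 * p.1 + κ.2 * p.2 = D := hp
  refine ⟨-(κ.1 • ContinuousLinearMap.fst ℝ ℝ ℝ + κ.2 • ContinuousLinearMap.snd ℝ ℝ ℝ), ?_⟩
  ext t
  simp only [mem_inter_iff, mem_ofPred_eq, neg_apply, add_apply,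
    smul_apply, ContinuousLinearMap.coe_fst', ContinuousLinearMap.coe_snd',
    smul_eq_mul, neg_le_neg_iff]
  refine and_congr_right fun htN => ⟨fun ht z hz => ?_, fun ht => ?_⟩
  · have ht' : κ.1 * t.1 + κ.2 * t.2 = D := ht
    rw [ht']
    exact hN z hz
  · exact le_antisymm ((ht p hpN).trans hp'.le) (hN t htN)

/-- The three conditions are necessary: otherwise the principal face is a compact edge whose
initial form vanishes somewhere to order greater than `d`. -/
theorem principalFace_of_isAdapted (hφ : ContDiffAt ℝ ∞ φ 0) (hne : (taylorSupport φ).Nonempty)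
    (had : IsAdapted φ) :
    (∃ F, IsPrincipalFace φ F ∧ IsEdge (newtonPolyhedron φ) F ∧ IsCompact F ∧
          ((circleOrder (facePart φ F) : ENNReal) : EReal) ≤ ((newtonDistance φ : ℝ) : EReal)) ∨
        (∃ F, IsPrincipalFace φ F ∧ IsVertex (newtonPolyhedron φ) F) ∨
        (∃ F, IsPrincipalFace φ F ∧ IsEdge (newtonPolyhedron φ) F ∧
          ¬ Bornology.IsBounded F) := by
  set d := newtonDistance φ with hd
  have hd0 : 0 ≤ d := newtonDistance_nonneg
  obtain ⟨κ, hκ1, hκ2, hκ, hsupp⟩ := exists_supporting_weight hne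
  rw [← hd] at hsupp
  have hN : ∀ t ∈ newtonPolyhedron φ, d ≤ κ.1 * t.1 + κ.2 * t.2 := fun t ht =>
    newtonPolyhedron_subset_halfPlane hκ1 hκ2 hsupp ht
  have hdN : ((d, d) : ℝ × ℝ) ∈ newtonPolyhedron φ := diag_mem_newtonPolyhedron hne
  set F := newtonPolyhedron φ ∩ weightLine κ d with hFdef
  have hdF : ((d, d) : ℝ × ℝ) ∈ F :=
    ⟨hdN, show κ.1 * d + κ.2 * d = d by rw [← add_mul, hκ, one_mul]⟩
  have hexp : IsExposed ℝ (newtonPolyhedron φ) F := isExposed_inter_weightLine hN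
  have hdim : dim F ≤ 1 :=
    dim_inter_weightLine_le (by nlinarith [sq_nonneg (κ.1 - κ.2), congrArg (· ^ 2) hκ]) _ hdF
  by_cases hvert : ∃ G, IsVertex (newtonPolyhedron φ) G ∧ ((d, d) : ℝ × ℝ) ∈ G
  · obtain ⟨G, hG, hdG⟩ := hvert
    exact Or.inr (Or.inl ⟨G, ⟨Or.inr hG, hdG, fun G' _ _ => hG.2.2.le.trans (Nat.zero_le _)⟩, hG⟩)
  push Not at hvert
  have hedge : IsEdge (newtonPolyhedron φ) F := by
    refine ⟨⟨_, hdF⟩, hexp, le_antisymm hdim (Nat.one_le_iff_ne_zero.2 fun h0 => ?_)⟩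
    exact hvert F ⟨⟨_, hdF⟩, hexp, h0⟩ hdF
  have hprin : IsPrincipalFace φ F := by
    refine ⟨Or.inl hedge, hdF, fun G hG hdG => ?_⟩
    rcases hG with hG | hG
    · rw [hG.2.2]; exact hdim
    · exact absurd hdG (hvert G hG)
  by_cases hbdd : Bornology.IsBounded F
  swap
  · exact Or.inr (Or.inr ⟨F, hprin, hedge, hbdd⟩)
  have hclosed : IsClosed F := isClosed_newtonPolyhedron.inter
    (isClosed_eq (by fun_prop) continuous_const)
  refine Or.inl ⟨F, hprin, hedge, Metric.isCompact_of_isClosed_isBounded hclosed hbdd, ?_⟩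
  -- a line parallel to an axis would cut out an unbounded face
  obtain ⟨C, hC⟩ := hbdd.exists_norm_le
  have hup : ∀ s t : ℝ, 0 ≤ s → 0 ≤ t → κ.1 * s + κ.2 * t = 0 → ((d + s, d + t) : ℝ × ℝ) ∈ F := by
    intro s t hs ht h
    refine ⟨newtonPolyhedron_upward hdN ⟨by simpa using hs, by simpa using ht⟩, ?_⟩
    change κ.1 * (d + s) + κ.2 * (d + t) = d
    linear_combination h + d * hκ
  have hC0 : 0 ≤ C := (norm_nonneg _).trans (hC _ hdF)
  have hκ1' : 0 < κ.1 := by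
    refine lt_of_le_of_ne hκ1 fun h0 => ?_
    have h1 := hC _ (hup (C + 1) 0 (by linarith) le_rfl (by rw [← h0]; ring))
    have h2 := (le_abs_self _).trans ((norm_fst_le _).trans h1)
    simp only at h2
    linarith
  have hκ2' : 0 < κ.2 := by
    refine lt_of_le_of_ne hκ2 fun h0 => ?_
    have h1 := hC _ (hup 0 (C + 1) le_rfl (by linarith) (by rw [← h0]; ring))
    have h2 := (le_abs_self _).trans ((norm_snd_le _).trans h1)
    simp only at h2
    linarith
  rw [hFdef, facePart_inter_weightLine hκ1' hκ2']
  refine coe_le_of_le_floor hd0 (iSup₂_le fun x hx => ?_)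
  by_contra! hlt
  set n := ⌊d⌋₊ + 1 with hn
  have hdn : d < (n : ℝ) := by
    rw [hn]
    push_cast
    exact Nat.lt_floor_add_one _
  have hDd : (κ.1 + κ.2) * d = d := by rw [hκ, one_mul]
  have hv : VanishesTo (initialForm φ κ d) x n := by
    rw [← le_vanishingOrder_iff (contDiff_initialForm hκ1' hκ2').contDiffAt, hn]
    push_cast
    exact Order.add_one_le_of_lt hlt
  obtain ⟨a, b⟩ := x
  have hb : b ≠ 0 := by
    rintro rfl
    have ha : a ≠ 0 := by
      rintro rfl
      simp at hx
    refine lt_irrefl d (lt_newtonDistance_of_tilt (e := (0, 1)) (c := n) hne hκ1' hκ2' hsupp le_rfl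
      zero_le_one hDd (by simpa using hdn) fun α hα => ?_)
    simpa [weight] using le_snd_of_vanishesTo hκ1' hκ2' ha hv hα
  have ha : a ≠ 0 := by
    rintro rfl
    refine lt_irrefl d (lt_newtonDistance_of_tilt (e := (1, 0)) (c := n) hne hκ1' hκ2' hsupp
      zero_le_one le_rfl hDd (by simpa using hdn) fun α hα => ?_)
    have := le_snd_of_vanishesTo (w := κ.swap) hκ2' hκ1' hb
      (vanishesTo_comp_swap hφ hκ1' hκ2' hv) (swap_mem_initialSupport hφ hκ1' hκ2' hα)
    simpa [weight] using this
  have hS : (initialSupport φ κ d).Nonempty := by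
    by_contra hc
    rw [Finset.not_nonempty_iff_eq_empty] at hc
    refine lt_irrefl d (lt_newtonDistance_of_tilt (e := (0, 1)) (c := n) hne hκ1' hκ2' hsupp le_rfl
      zero_le_one hDd (by simpa using hdn) fun α hα => ?_)
    rw [hc] at hα
    simp at hα
  obtain ⟨k, hk, hratio⟩ := exists_nat_weight_ratio hκ1' hκ2' hd0 hDd.symm hdn
    (lt_card_initialSupport hκ1' hκ2' ha hb hS hv)
  obtain ⟨ψ, h1, h2, h3, h4⟩ :=
    exists_diffeomorphism hφ hκ1' hκ2' hk hratio hsupp hDd hdn hS ha hb hv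
  have h5 := newtonDistance_le_height φ h1 h2 h3
  rw [had, EReal.coe_le_coe_iff] at h5
  exact absurd h4 (not_lt.2 h5)

end

end NewtonHeight

theorem proposition2p1 (φ : ℝ × ℝ → ℝ) (Ω : Set (ℝ × ℝ)) (hΩ : IsOpen Ω)
    (h0 : (0 : ℝ × ℝ) ∈ Ω) (hsmooth : ContDiffOn ℝ ∞ φ Ω)
    (hzero : φ 0 = 0) (hgrad : fderiv ℝ φ 0 = 0)
    (hfinite : (taylorSupport φ).Nonempty) :
    IsAdapted φ ↔
      ((∃ F, IsPrincipalFace φ F ∧ IsEdge (newtonPolyhedron φ) F ∧ IsCompact F ∧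
          ((circleOrder (facePart φ F) : ENNReal) : EReal) ≤ ((newtonDistance φ : ℝ) : EReal)) ∨
        (∃ F, IsPrincipalFace φ F ∧ IsVertex (newtonPolyhedron φ) F) ∨
        (∃ F, IsPrincipalFace φ F ∧ IsEdge (newtonPolyhedron φ) F ∧
          ¬ Bornology.IsBounded F)) := by
  have hφ : ContDiffAt ℝ ∞ φ 0 := hsmooth.contDiffAt (hΩ.mem_nhds h0)
  refine ⟨principalFace_of_isAdapted hφ hfinite, fun h => ?_⟩
  have hb := initialFormBound_of_principalFace hfinite h
  refine le_antisymm (iSup₂_le fun y hy => ?_) ?_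
  · obtain ⟨hψ, hψ0, hdet⟩ := jacobianNeZero_of_isLocalCoordinates hy
    rw [EReal.coe_le_coe_iff]
    refine newtonDistance_comp_le hφ hψ hψ0 hfinite hb (fun m hm => ?_) hdet
    exact (Nat.le_floor_iff newtonDistance_nonneg).1 (Nat.lt_succ_iff.1 hm)
  · exact newtonDistance_le_height φ (ψ := Homeomorph.refl _) contDiff_id contDiff_id rfl
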